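/- A rooted chord diagram $C$ with $|C|=n$ chords consists of $2n$ points on a circle, one of which is distinguished as the root, the points being numbered $p_1,\dots,p_{2n}$ counterclockwise starting with $p_1$ the root, together with a partition of these points into $n$ pairs, called chords. The counterclockwise order of the chords is the order of their first endpoints. The directed intersection graph of $C$ has the chords as vertices and an edge $c\to d$ whenever the chords $c$ and $d$ cross and $c$ precedes $d$ in the counterclockwise order. The diagram is connected if $n\geq 1$ and its intersection graph is connected (ignoring directions). Let $\mathcal{RCCD}$ be the set of rooted connected chord diagrams. The intersection order of the chords of $C\in\mathcal{RCCD}$ is defined recursively on the intersection graph: the first chord in the counterclockwise order comes first; deleting its edges leaves, besides that chord, connected components, which are listed one after the other by increasing (in the counterclockwise order) smallest chord, the chords within each component being ordered recursively by the same procedure. Label the chords $1,\dots,n$ in the intersection order. A chord is terminal if it has no outgoing edge in the directed intersection graph. Let $t_1<t_2<\dots<t_{k+1}$ be the labels of the terminal chords of $C$, let $b(C)=t_1$, and let $\delta_m=t_{m+1}-t_m$ for $1\leq m\leq k$. Given elements $f_0,f_1,f_2,\dots$ of a commutative semiring, put $$f_C=f_0^{\,n-k-1}f_{\delta_1}f_{\delta_2}\cdots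 f_{\delta_k}.$$ Then for all integers $i\geq 1$ and $j\geq 1$, $$\sum_{\substack{C\in\mathcal{RCCD}\\ |C|=i+1\\ b(C)=j+1}} f_C=\sum_{k=1}^{i}\sum_{\ell=1}^{j}\binom{j}{\ell}\left(\sum_{\substack{C\in\mathcal{RCCD}\\ |C|=k\\ b(C)\geq \ell}} f_C\,f_{b(C)-\ell}\right)\left(\sum_{\substack{C\in\mathcal{RCCD}\\ |C|=i-k+1\\ b(C)=j-\ell+1}} f_C\right).$$ -/

import Mathlib

/-- A rooted chord diagram with `n` chords. The `2n` points on the circle are numbered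
`0, …, 2n-1` counterclockwise starting with the root, and the chords are the pairs
`{x, partner x}` for a fixed-point-free involution `partner`. -/
def RootedChordDiagram (n : ℕ) : Type :=
  {partner : Fin (2 * n) → Fin (2 * n) //
    (∀ x, partner (partner x) = x) ∧ ∀ x, partner x ≠ x}

instance (n : ℕ) : Fintype (RootedChordDiagram n) :=
  inferInstanceAs (Fintype {partner : Fin (2 * n) → Fin (2 * n) //
    (∀ x, partner (partner x) = x) ∧ ∀ x, partner x ≠ x})

section IntersectionOrder

variable {V : Type*} [Fintype V] [LinearOrder V] (G : SimpleGraph V) [DecidableRel G.Adj]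

/-- The vertex set of the connected component of `u` in the subgraph of `G` induced on `T`. -/
def componentIn (T : Finset V) (u : V) : Finset V :=
  {w ∈ T | (G.induce (T : Set V)).spanningCoe.Reachable u w}

/-- The recursive procedure behind the intersection order, on a finite graph with linearly
ordered vertices. The components of the subgraph induced on `T` are listed by increasing smallest
vertex; within each component `K` the smallest vertex `u` comes first, and the rest of `K`, i.e.
what is left of `K` once the edges at `u` are deleted, is treated recursively in the same way. -/
def componentwiseOrder (T : Finset V) : List V :=
  if h : T.Nonempty then
    T.min' h ::
      (componentwiseOrder ((componentIn G T (T.min' h)).erase (T.min' h)) ++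
        componentwiseOrder (T \ componentIn G T (T.min' h)))
  else []
termination_by T.card
decreasing_by
  · refine Finset.card_lt_card (Finset.ssubset_iff.2 ⟨T.min' h, by simp, ?_⟩)
    refine Finset.insert_subset (T.min'_mem h) ((Finset.erase_subset _ _).trans ?_)
    exact Finset.filter_subset _ _
  · refine Finset.card_lt_card (Finset.ssubset_iff.2 ⟨T.min' h, ?_, ?_⟩)
    · simp [componentIn, T.min'_mem h]
    · exact Finset.insert_subset (T.min'_mem h) Finset.sdiff_subset

end IntersectionOrder

namespace RootedChordDiagram

variable {n : ℕ} (C : RootedChordDiagram n)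

/-- The chords of `C`, each represented by the endpoint met first when going counterclockwise
from the root. The order inherited from `Fin (2 * n)` is the counterclockwise order of the
chords. -/
abbrev Chord : Type := {x : Fin (2 * n) // x < C.1 x}

/-- The directed intersection graph: there is an edge from `c` to `d` if the two chords intersect
and `c` precedes `d` in the counterclockwise order. -/
abbrev Edge (c d : C.Chord) : Prop := c.1 < d.1 ∧ d.1 < C.1 c.1 ∧ C.1 c.1 < C.1 d.1

/-- The underlying undirected intersection graph. -/
def intersectionGraph : SimpleGraph C.Chord where
  Adj c d := C.Edge c d ∨ C.Edge d c
  symm := ⟨fun _ _ h => h.symm⟩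
  loopless := ⟨fun _ h => (h.elim (·.1) (·.1)).false⟩

instance : DecidableRel C.intersectionGraph.Adj :=
  fun c d => inferInstanceAs (Decidable (C.Edge c d ∨ C.Edge d c))

/-- `C` is connected if the union of its chords, without the circle, is connected. -/
abbrev Connected : Prop := C.intersectionGraph.Connected

/-- A chord is terminal if it has no outgoing edge in the directed intersection graph. -/
abbrev IsTerminal (c : C.Chord) : Prop := ∀ d, ¬ C.Edge c d

/-- The list of all chords of `C` in the intersection order. -/
def intersectionOrder : List C.Chord := componentwiseOrder C.intersectionGraph Finset.univ

/-- The label in `{1, …, n}` of a chord in the intersection order. -/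
def label (c : C.Chord) : ℕ := C.intersectionOrder.idxOf c + 1

/-- The increasing sequence of the labels of the terminal chords. -/
def terminalLabels : List ℕ := (C.intersectionOrder.filter (C.IsTerminal ·)).map C.label

/-- The label of the first terminal chord (with value `0` for the empty diagram only). -/
def b : ℕ := C.terminalLabels.headD 0

/-- The sequence of differences of consecutive terminal labels. -/
def gaps : List ℕ := List.zipWith (fun s t => t - s) C.terminalLabels C.terminalLabels.tail

/-- The monomial `f_C = f₀ ^ (n - k - 1) * f_{δ₁} * ⋯ * f_{δₖ}`, where `δ₁, …, δₖ` are the gaps. -/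
def monomial {R : Type*} [CommSemiring R] (f : ℕ → R) : R :=
  f 0 ^ (n - C.gaps.length - 1) * (C.gaps.map f).prod

end RootedChordDiagram

/-- The finite set of rooted connected chord diagrams with `n` chords. -/
def RCCD (n : ℕ) : Finset (RootedChordDiagram n) := {C | C.Connected}

/-! Let a_j be the generating function, by number of chords, of f_C over connected C with b(C) = j +
1, and h_l that of f_C f_{b(C)-l} over b(C) ≥ l. The claim is the coefficient of x^{i+1} in a_j =
∑_{l=1}^{j} binom(j,l) h_l a_{j-l}.

Both sequences come from one decomposition. In a connected C with at least two chords delete the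
root chord; let D be the first remaining component, with m chords, and R the root chord together
with all other chords. Since C is connected, the points of R other than the root fill one of the 2m
- 1 gaps between consecutive points of D. Conversely, connected R and D and a gap glue to a
connected diagram, because some chord of D straddles the gap and the root chord crosses it. The
intersection order of C is its root, then D, then R without its root. The root of C is not terminal
and the last chord of D is, whence b(C) = b(D) + 1 and f_C = f_R f_{b(R)-1} f_D (`exists_split`,
`IsSplit.shape_eq`, `IsSplit.b_eq_add_one`, `IsSplit.monomial_eq_mul`).

With Δ = 2x d/dx - 1 (`oddScale`) this says a_{j+1} = h_1 Δa_j and h_{l+1} = h_1 Δh_l for l ≥ 1,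
while a_0 = x is fixed by Δ. Since Δ + 1 is a derivation, Δ(ab) = Δa·b + a·Δb + ab. Applying h_1 Δ
to the identity for j, the first two terms combine by Pascal's rule, and the third terms add up to
h_1 a_j, exactly what Pascal's rule lacks at l = 1 (`eq_sum_choose_of_recurrence`). -/

section Order

/-! ### Components and the recursive order of a graph. -/

variable {V : Type*} [Fintype V] [LinearOrder V] (G : SimpleGraph V) [DecidableRel G.Adj]

theorem mem_componentIn {T : Finset V} {u w : V} :
    w ∈ componentIn G T u ↔ w ∈ T ∧ (G.induce (T : Set V)).spanningCoe.Reachable u w := by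
  simp [componentIn]

theorem spanningCoe_induce_adj {V : Type*} (G : SimpleGraph V) {T : Finset V} {a b : V} :
    (G.induce (T : Set V)).spanningCoe.Adj a b ↔ a ∈ T ∧ b ∈ T ∧ G.Adj a b := by
  simp only [SimpleGraph.spanningCoe, SimpleGraph.map_adj]
  constructor
  · rintro ⟨x, y, h, rfl, rfl⟩
    exact ⟨x.2, y.2, h⟩
  · rintro ⟨ha, hb, h⟩
    exact ⟨⟨a, ha⟩, ⟨b, hb⟩, h, rfl, rfl⟩

theorem SimpleGraph.Reachable.induct {V : Type*} {G : SimpleGraph V} {P : V → Prop} {u v : V}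
    (h : G.Reachable u v) (hu : P u) (hP : ∀ a b, P a → G.Adj a b → P b) : P v := by
  obtain ⟨p⟩ := h
  induction p with
  | nil => exact hu
  | cons hab _ ih => exact ih (hP _ _ hu hab)

theorem componentIn_subset (T : Finset V) (u : V) : componentIn G T u ⊆ T :=
  Finset.filter_subset _ _

theorem self_mem_componentIn {T : Finset V} {u : V} (hu : u ∈ T) : u ∈ componentIn G T u :=
  (mem_componentIn G).2 ⟨hu, SimpleGraph.Reachable.refl _⟩

theorem mem_componentIn_of_adj {T : Finset V} {u a b : V} (ha : a ∈ componentIn G T u)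
    (hb : b ∈ T) (h : G.Adj a b) : b ∈ componentIn G T u := by
  rw [mem_componentIn] at ha ⊢
  exact ⟨hb, ha.2.trans ((spanningCoe_induce_adj G).2 ⟨ha.1, hb, h⟩).reachable⟩

theorem componentIn_induct {T : Finset V} {u w : V} {P : V → Prop} (hw : w ∈ componentIn G T u)
    (hu : P u) (hP : ∀ a b, P a → a ∈ T → b ∈ T → G.Adj a b → P b) : P w := by
  rw [mem_componentIn] at hw
  refine hw.2.induct hu fun a b ha hab => ?_
  rw [spanningCoe_induce_adj] at hab
  exact hP a b ha hab.1 hab.2.1 hab.2.2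

/-- The component of `u` is the only set containing `u` that is closed under adjacency within `T`
and satisfies the induction principle of a component. -/
theorem componentIn_eq {T K : Finset V} {u : V} (hu : u ∈ K)
    (hK : ∀ a ∈ K, ∀ b ∈ T, G.Adj a b → b ∈ K)
    (hind : ∀ w ∈ K, w ∈ componentIn G T u) : componentIn G T u = K := by
  ext w
  refine ⟨fun hw => ?_, hind w⟩
  exact componentIn_induct G (P := (· ∈ K)) hw hu fun a b ha _ hb hab => hK a ha b hb hab

theorem componentIn_map {W : Type*} [Fintype W] [LinearOrder W] (H : SimpleGraph W)
    [DecidableRel H.Adj] (e : V ↪o W) (he : ∀ a b, H.Adj (e a) (e b) ↔ G.Adj a b)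
    (T : Finset V) {u : V} (hu : u ∈ T) :
    componentIn H (T.map e.toEmbedding) (e u) = (componentIn G T u).map e.toEmbedding := by
  apply componentIn_eq
  · exact Finset.mem_map_of_mem e.toEmbedding (self_mem_componentIn G hu)
  · intro a ha b hb hab
    obtain ⟨a, ha', rfl⟩ := Finset.mem_map.1 ha
    obtain ⟨b, hb', rfl⟩ := Finset.mem_map.1 hb
    exact Finset.mem_map_of_mem _ (mem_componentIn_of_adj G ha' hb' ((he a b).1 hab))
  · intro w hw
    obtain ⟨w, hw', rfl⟩ := Finset.mem_map.1 hw
    refine componentIn_induct G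
      (P := fun w => e w ∈ componentIn H (T.map e.toEmbedding) (e u)) hw' ?_ ?_
    · exact self_mem_componentIn H (Finset.mem_map_of_mem e.toEmbedding hu)
    · intro a b ha _ hb hab
      exact mem_componentIn_of_adj H ha (Finset.mem_map_of_mem e.toEmbedding hb) ((he a b).2 hab)

theorem componentwiseOrder_empty : componentwiseOrder G ∅ = [] := by
  rw [componentwiseOrder]; simp

theorem componentwiseOrder_of_isLeast {T : Finset V} {u : V} (hu : u ∈ T) (h : ∀ w ∈ T, u ≤ w) :
    componentwiseOrder G T = u :: (componentwiseOrder G ((componentIn G T u).erase u) ++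
      componentwiseOrder G (T \ componentIn G T u)) := by
  have hT : T.Nonempty := ⟨u, hu⟩
  have hm : T.min' hT = u := le_antisymm (T.min'_le _ hu) (h _ (T.min'_mem hT))
  rw [componentwiseOrder, dif_pos hT, hm]

theorem componentwiseOrder_eq_cons {T A B : Finset V} {u : V} (hu : u ∈ T) (h : ∀ w ∈ T, u ≤ w)
    (hA : ∀ w, w ∈ A ↔ w ≠ u ∧ w ∈ componentIn G T u)
    (hB : ∀ w, w ∈ B ↔ w ∈ T ∧ w ∉ componentIn G T u) :
    componentwiseOrder G T = u :: (componentwiseOrder G A ++ componentwiseOrder G B) := by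
  have eA : (componentIn G T u).erase u = A := by ext w; rw [hA, Finset.mem_erase]
  have eB : T \ componentIn G T u = B := by ext w; rw [hB, Finset.mem_sdiff]
  rw [componentwiseOrder_of_isLeast G hu h, eA, eB]

/-- Induction along the recursion of `componentwiseOrder`. -/
theorem componentwiseOrder_induct {P : Finset V → Prop} (h0 : P ∅)
    (h : ∀ T u, u ∈ T → (∀ w ∈ T, u ≤ w) → P ((componentIn G T u).erase u) →
      P (T \ componentIn G T u) → P T) (T : Finset V) : P T := by
  induction hc : T.card using Nat.strong_induction_on generalizing T with
  | _ c ih =>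
    subst hc
    rcases T.eq_empty_or_nonempty with rfl | hT
    · exact h0
    · have hu := self_mem_componentIn G (T.min'_mem hT)
      refine h T _ (T.min'_mem hT) (fun w hw => T.min'_le w hw) (ih _ ?_ _ rfl) (ih _ ?_ _ rfl)
      · exact (Finset.card_erase_lt_of_mem hu).trans_le
          (Finset.card_le_card (componentIn_subset G _ _))
      · exact Finset.card_lt_card (Finset.sdiff_ssubset (componentIn_subset G _ _) ⟨_, hu⟩)

theorem mem_componentwiseOrder {T : Finset V} {w : V} : w ∈ componentwiseOrder G T ↔ w ∈ T := by
  induction T using componentwiseOrder_induct G with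
  | h0 => simp [componentwiseOrder_empty]
  | h T u hu hmin h1 h2 =>
    rw [componentwiseOrder_of_isLeast G hu hmin, List.mem_cons, List.mem_append, h1, h2,
      Finset.mem_erase, Finset.mem_sdiff]
    have := self_mem_componentIn G hu
    have := @componentIn_subset _ _ _ G _ T u w
    grind

theorem nodup_componentwiseOrder (T : Finset V) : (componentwiseOrder G T).Nodup := by
  induction T using componentwiseOrder_induct G with
  | h0 => simp [componentwiseOrder_empty]
  | h T u hu hmin h1 h2 =>
    rw [componentwiseOrder_of_isLeast G hu hmin]
    simp only [List.nodup_cons, List.nodup_append, List.mem_append, mem_componentwiseOrder,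
      Finset.mem_erase, Finset.mem_sdiff]
    have := self_mem_componentIn G hu
    refine ⟨by tauto, h1, h2, ?_⟩
    rintro a ⟨_, ha⟩ b ⟨_, hb⟩ rfl
    exact hb ha

/-- The recursion sees only adjacency and smallest vertices, and both are transported by the
embedding. This carries the orders of two diagrams into the diagram glued from them. -/
theorem componentwiseOrder_map {W : Type*} [Fintype W] [LinearOrder W] (H : SimpleGraph W)
    [DecidableRel H.Adj] (e : V ↪o W) (he : ∀ a b, H.Adj (e a) (e b) ↔ G.Adj a b)
    (T : Finset V) :
    componentwiseOrder H (T.map e.toEmbedding) = (componentwiseOrder G T).map e := by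
  induction T using componentwiseOrder_induct G with
  | h0 => simp [componentwiseOrder_empty]
  | h T u hu hmin h1 h2 =>
    rw [componentwiseOrder_of_isLeast G hu hmin,
      componentwiseOrder_of_isLeast H (u := e u) (Finset.mem_map_of_mem e.toEmbedding hu),
      componentIn_map G H e he T hu, ← Finset.map_sdiff, h2]
    · have : e u = e.toEmbedding u := rfl
      rw [this, ← Finset.map_erase, h1]
      simp
    · intro w hw
      obtain ⟨w, hw', rfl⟩ := Finset.mem_map.1 hw
      exact e.le_iff_le.2 (hmin w hw')

/-- Follow the last nonempty block of the recursion down to one vertex: the vertices discarded on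
the way are smaller or in another component. For diagrams this makes the last chord terminal. -/
theorem exists_componentwiseOrder_eq_append {T : Finset V} (hT : T.Nonempty) :
    ∃ l c, componentwiseOrder G T = l ++ [c] ∧ ∀ d ∈ T, G.Adj c d → d < c := by
  induction T using componentwiseOrder_induct G with
  | h0 => simp at hT
  | h T u hu hmin h1 h2 =>
    rw [componentwiseOrder_of_isLeast G hu hmin]
    rcases (T \ componentIn G T u).eq_empty_or_nonempty with h | h
    · have hTK : T ⊆ componentIn G T u := Finset.sdiff_eq_empty_iff_subset.1 h
      rcases ((componentIn G T u).erase u).eq_empty_or_nonempty with h' | h'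
      · refine ⟨[], u, by simp [h, h', componentwiseOrder_empty], fun d hd hud => ?_⟩
        have : d ∈ (componentIn G T u).erase u :=
          Finset.mem_erase.2 ⟨hud.ne', hTK hd⟩
        simp [h'] at this
      · obtain ⟨l, c, hl, hc⟩ := h1 h'
        refine ⟨u :: l, c, by simp [h, hl, componentwiseOrder_empty], fun d hd hcd => ?_⟩
        by_cases hdu : d = u
        · have hcmem : c ∈ (componentIn G T u).erase u := by
            rw [← mem_componentwiseOrder G, hl]; simp
          have hcT := componentIn_subset G _ _ (Finset.mem_erase.1 hcmem).2
          exact hdu ▸ lt_of_le_of_ne (hmin c hcT) (Finset.mem_erase.1 hcmem).1.symm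
        · exact hc d (Finset.mem_erase.2 ⟨hdu, hTK hd⟩) hcd
    · obtain ⟨l, c, hl, hc⟩ := h2 h
      refine ⟨u :: (componentwiseOrder G ((componentIn G T u).erase u) ++ l), c, by simp [hl],
        fun d hd hcd => hc d (Finset.mem_sdiff.2 ⟨hd, fun hdK => ?_⟩) hcd⟩
      have hcmem : c ∈ T \ componentIn G T u := by
        rw [← mem_componentwiseOrder G, hl]; simp
      rw [Finset.mem_sdiff] at hcmem
      exact hcmem.2 (mem_componentIn_of_adj G hdK hcmem.1 hcd.symm)

theorem componentIn_univ_of_connected (hG : G.Connected) (u : V) :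
    componentIn G Finset.univ u = Finset.univ := by
  refine componentIn_eq G (Finset.mem_univ _)
    (fun _ _ _ _ _ => Finset.mem_univ _) fun w _ => ?_
  refine (hG.preconnected u w).induct (P := (· ∈ componentIn G Finset.univ u))
    (self_mem_componentIn G (Finset.mem_univ _)) fun a b ha hab => ?_
  exact mem_componentIn_of_adj G ha (Finset.mem_univ _) hab

end Order

/-! ### Calculus of words marking terminal chords. -/

section Words

/-- The positions, counted from `1`, of the letter `true` in a word. -/
def truePositions : List Bool → List ℕ
  | [] => []
  | b :: w => (if b then [1] else []) ++ (truePositions w).map (· + 1)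

/-- This replaces labels of chords by positions in a Boolean word, so that b(C) and f_C depend on
the word alone. -/
theorem map_filter_idxOf {α : Type*} [DecidableEq α] (p : α → Bool) {l : List α} (hl : l.Nodup) :
    (l.filter p).map (fun c => l.idxOf c + 1) = truePositions (l.map p) := by
  induction l with
  | nil => rfl
  | cons a l ih =>
    rw [List.nodup_cons] at hl
    have h : (l.filter p).map (fun c => (a :: l).idxOf c + 1) =
        (truePositions (l.map p)).map (· + 1) := by
      rw [← ih hl.2, List.map_map]
      refine List.map_congr_left fun c hc => ?_
      have : a ≠ c := fun h => hl.1 (h ▸ (List.mem_filter.1 hc).1)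
      simp [List.idxOf_cons_ne _ this]
    rw [List.filter_cons, List.map_cons, truePositions, ← h]
    by_cases hp : p a <;> simp [hp]

/-- The differences of consecutive entries of a list. -/
def differences (l : List ℕ) : List ℕ := List.zipWith (fun s t => t - s) l l.tail

/-- The monomial attached to a word that marks the terminal chords. -/
def wordMonomial {R : Type*} [CommSemiring R] (f : ℕ → R) (w : List Bool) : R :=
  f 0 ^ (w.length - (differences (truePositions w)).length - 1) *
    ((differences (truePositions w)).map f).prod

/-- The position of the first `true` of a word. -/
def firstTrue (w : List Bool) : ℕ := (truePositions w).headD 0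

theorem truePositions_append (u v : List Bool) :
    truePositions (u ++ v) = truePositions u ++ (truePositions v).map (· + u.length) := by
  induction u with
  | nil => simp [truePositions]
  | cons b u ih => simp [truePositions, ih, Function.comp_def, add_assoc]

theorem differences_map_add (l : List ℕ) (a : ℕ) :
    differences (l.map (· + a)) = differences l := by
  induction l with
  | nil => rfl
  | cons x l ih =>
    cases l with
    | nil => rfl
    | cons y l => exact congrArg₂ List.cons (Nat.add_sub_add_right y a x) ih

theorem differences_append (l : List ℕ) (x y : ℕ) (m : List ℕ) :
    differences ((l ++ [x]) ++ y :: m) =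
      differences (l ++ [x]) ++ (y - x) :: differences (y :: m) := by
  induction l with
  | nil => simp [differences]
  | cons z l ih =>
    cases l with
    | nil => simp [differences]
    | cons z' l => simpa [differences] using ih

theorem length_truePositions_le (w : List Bool) : (truePositions w).length ≤ w.length := by
  induction w with
  | nil => simp [truePositions]
  | cons b w ih => cases b <;> simp [truePositions] <;> omega

theorem length_differences (l : List ℕ) : (differences l).length = l.length - 1 := by
  simp [differences]

theorem truePositions_append_true (w : List Bool) :
    truePositions (w ++ [true]) = truePositions w ++ [w.length + 1] := by
  simp [truePositions_append, truePositions, add_comm]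

theorem exists_truePositions_append_true (w : List Bool) :
    ∃ x l, truePositions (w ++ [true]) = x :: l ∧ 1 ≤ x := by
  induction w with
  | nil => exact ⟨1, [], rfl, le_rfl⟩
  | cons b w ih =>
    obtain ⟨x, l, h, hx⟩ := ih
    cases b
    · exact ⟨x + 1, l.map (· + 1), by simp [truePositions, h], by omega⟩
    · exact ⟨1, (truePositions (w ++ [true])).map (· + 1), by simp [truePositions], le_rfl⟩

theorem one_le_firstTrue (w : List Bool) : 1 ≤ firstTrue (w ++ [true]) := by
  obtain ⟨x, l, h, hx⟩ := exists_truePositions_append_true w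
  simpa [firstTrue, h] using hx

theorem firstTrue_false_cons_append (u v : List Bool) :
    firstTrue (false :: ((u ++ [true]) ++ v)) = firstTrue (u ++ [true]) + 1 := by
  obtain ⟨x, l, h, hx⟩ := exists_truePositions_append_true u
  rw [firstTrue, truePositions, truePositions_append, h]
  simp [firstTrue, h]

variable {R : Type*} [CommSemiring R] (f : ℕ → R)

theorem wordMonomial_false_cons (u : List Bool) :
    wordMonomial f (false :: (u ++ [true])) = f 0 * wordMonomial f (u ++ [true]) := by
  obtain ⟨x, l, h, hx⟩ := exists_truePositions_append_true u
  have hlen := length_truePositions_le (u ++ [true])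
  have h' : truePositions (false :: (u ++ [true])) = (truePositions (u ++ [true])).map (· + 1) := by
    simp [truePositions]
  rw [wordMonomial, wordMonomial, h', differences_map_add, ← mul_assoc, ← pow_succ']
  congr 2
  rw [length_differences]
  rw [h] at hlen ⊢
  simp at hlen ⊢
  omega

/-- The first word ends in `true`, so the only new gap, across the junction, has length `firstTrue`
of the second word. -/
theorem wordMonomial_append (u v : List Bool) :
    wordMonomial f ((u ++ [true]) ++ (v ++ [true])) =
      wordMonomial f (u ++ [true]) *
        (wordMonomial f (v ++ [true]) * f (firstTrue (v ++ [true]))) := by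
  obtain ⟨x, l, h, hx⟩ := exists_truePositions_append_true v
  have hu := length_truePositions_le u
  have hv := length_truePositions_le (v ++ [true])
  have key : differences (truePositions ((u ++ [true]) ++ (v ++ [true]))) =
      differences (truePositions (u ++ [true])) ++
        firstTrue (v ++ [true]) :: differences (truePositions (v ++ [true])) := by
    have h2 : differences (truePositions (v ++ [true])) =
        differences ((x + (u ++ [true]).length) :: l.map (· + (u ++ [true]).length)) := by
      rw [← differences_map_add _ (u ++ [true]).length, h, List.map_cons]
    rw [truePositions_append, truePositions_append_true u, h2, firstTrue, h, List.map_cons,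
      differences_append]
    simp
  simp only [wordMonomial, key, List.map_append, List.map_cons, List.prod_append, List.prod_cons]
  -- There is one gap fewer than letters `true`, so each exponent counts the letters `false`, and
  -- these counts add.
  have : ((u ++ [true]) ++ (v ++ [true])).length -
      (differences (truePositions (u ++ [true])) ++ firstTrue (v ++ [true]) ::
        differences (truePositions (v ++ [true]))).length - 1 =
      ((u ++ [true]).length - (differences (truePositions (u ++ [true]))).length - 1) +
      ((v ++ [true]).length - (differences (truePositions (v ++ [true]))).length - 1) := by
    have h1 : (differences (truePositions (u ++ [true]))).length = (truePositions u).length := by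
      rw [length_differences, truePositions_append_true]; simp
    have h3 : (differences (truePositions (v ++ [true]))).length + 1
        = (truePositions (v ++ [true])).length := by
      rw [length_differences, h]; simp
    simp only [List.length_append, List.length_cons, h1, List.length_nil] at hv h3 ⊢
    omega
  rw [this, pow_add]
  ring

theorem wordMonomial_singleton_true : wordMonomial f [true] = 1 := by
  simp [wordMonomial, truePositions, differences]

theorem firstTrue_singleton_true : firstTrue [true] = 1 := rfl

end Words

/-! ### Chords, root and word of a diagram. -/

namespace RootedChordDiagram

variable {n : ℕ} (C : RootedChordDiagram n)

/-- The word marking the terminal chords along the intersection order. -/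
def word : List Bool := C.intersectionOrder.map (C.IsTerminal ·)

theorem terminalLabels_eq : C.terminalLabels = truePositions C.word := by
  have h := map_filter_idxOf (C.IsTerminal ·)
    (nodup_componentwiseOrder C.intersectionGraph Finset.univ)
  unfold terminalLabels label word intersectionOrder
  convert h

theorem b_eq : C.b = firstTrue C.word := by rw [b, terminalLabels_eq, firstTrue]

theorem partner_partner (x : Fin (2 * n)) : C.1 (C.1 x) = x := C.2.1 x

theorem partner_ne (x : Fin (2 * n)) : C.1 x ≠ x := C.2.2 x

end RootedChordDiagram

namespace RootedChordDiagram

variable {n : ℕ} (C : RootedChordDiagram n)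

theorem partner_injective : Function.Injective C.1 := fun x y h => by
  rw [← C.partner_partner x, h, C.partner_partner]

theorem card_chord : Fintype.card C.Chord = n := by
  have h1 : Fintype.card C.Chord = (Finset.univ.filter fun x => x < C.1 x).card :=
    Fintype.card_subtype _
  have h2 : (Finset.univ.filter fun x => x < C.1 x).card =
      (Finset.univ.filter fun x => ¬ x < C.1 x).card := by
    refine Finset.card_bij (fun x _ => C.1 x) ?_ (fun _ _ _ _ h => C.partner_injective h) ?_
    · intro x hx
      rw [Finset.mem_filter] at hx ⊢
      rw [C.partner_partner]
      exact ⟨Finset.mem_univ _, hx.2.le.not_gt⟩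
    · intro x hx
      rw [Finset.mem_filter] at hx
      refine ⟨C.1 x, ?_, C.partner_partner x⟩
      rw [Finset.mem_filter, C.partner_partner]
      exact ⟨Finset.mem_univ _, lt_of_le_of_ne (not_lt.1 hx.2) (C.partner_ne x)⟩
  have h3 := Finset.card_filter_add_card_filter_not (s := Finset.univ) fun x => x < C.1 x
  rw [Finset.card_univ, Fintype.card_fin] at h3
  omega

theorem length_intersectionOrder : C.intersectionOrder.length = n := by
  refine Eq.trans ?_ C.card_chord
  rw [intersectionOrder, ← List.toFinset_card_of_nodup (nodup_componentwiseOrder _ _)]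
  refine congrArg Finset.card (Finset.ext fun c => ?_)
  simp [mem_componentwiseOrder]

theorem monomial_eq {R : Type*} [CommSemiring R] (f : ℕ → R) :
    C.monomial f = wordMonomial f C.word := by
  have h : C.gaps = differences (truePositions C.word) := by
    rw [← terminalLabels_eq]; rfl
  have hl : C.word.length = n := (List.length_map _).trans C.length_intersectionOrder
  rw [monomial, wordMonomial, h, hl]

theorem edge_iff_adj_and_lt {c d : C.Chord} :
    C.Edge c d ↔ C.intersectionGraph.Adj c d ∧ c < d := by
  constructor
  · intro h
    exact ⟨Or.inl h, h.1⟩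
  · rintro ⟨h | h, hlt⟩
    · exact h
    · exact absurd h.1 (not_lt.2 (le_of_lt hlt))

/-- The chord through a given point. -/
def chordAt (y : Fin (2 * n)) : C.Chord :=
  if h : y < C.1 y then ⟨y, h⟩
  else ⟨C.1 y, by
    rw [C.partner_partner]; exact lt_of_le_of_ne (not_lt.1 h) (C.partner_ne y)⟩

theorem chordAt_of_lt {y : Fin (2 * n)} (h : y < C.1 y) : C.chordAt y = ⟨y, h⟩ := dif_pos h

theorem chordAt_chord (c : C.Chord) : C.chordAt c.1 = c := chordAt_of_lt C c.2

theorem chordAt_partner (y : Fin (2 * n)) : C.chordAt (C.1 y) = C.chordAt y := by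
  have hne := C.partner_ne y
  have hp := C.partner_partner y
  unfold chordAt
  by_cases h : y < C.1 y
  · have h' : ¬ C.1 y < C.1 (C.1 y) := by rw [hp]; exact h.le.not_gt
    rw [dif_pos h, dif_neg h']
    exact Subtype.ext hp
  · have h' : C.1 y < C.1 (C.1 y) := by rw [hp]; exact lt_of_le_of_ne (not_lt.1 h) hne
    rw [dif_neg h, dif_pos h']

theorem eq_or_eq_of_chordAt (y : Fin (2 * n)) :
    y = (C.chordAt y).1 ∨ y = C.1 (C.chordAt y).1 := by
  by_cases h : y < C.1 y
  · exact Or.inl (by rw [chordAt_of_lt C h])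
  · right
    unfold chordAt
    rw [dif_neg h]
    exact (C.partner_partner y).symm

/-- The first point of a nonempty diagram. -/
def rootPoint (hn : 0 < n) : Fin (2 * n) := ⟨0, by omega⟩

theorem rootPoint_le (hn : 0 < n) (x : Fin (2 * n)) : rootPoint hn ≤ x :=
  Fin.le_def.2 (Nat.zero_le _)

theorem rootPoint_lt_partner (hn : 0 < n) : rootPoint hn < C.1 (rootPoint hn) :=
  lt_of_le_of_ne (rootPoint_le hn _) (C.partner_ne _).symm

/-- The root chord of a nonempty diagram. -/
def root (hn : 0 < n) : C.Chord := ⟨rootPoint hn, C.rootPoint_lt_partner hn⟩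

theorem root_val (hn : 0 < n) : (C.root hn).1.1 = 0 := rfl

theorem root_le (hn : 0 < n) (c : C.Chord) : C.root hn ≤ c := rootPoint_le hn c.1

theorem pos_of_connected {C : RootedChordDiagram n} (hC : C.Connected) : 0 < n := by
  obtain ⟨c⟩ := hC.nonempty
  have := c.1.2
  omega

theorem connected_iff (hn : 0 < n) :
    C.Connected ↔ ∀ c, C.intersectionGraph.Reachable (C.root hn) c := by
  constructor
  · intro h c
    exact h.preconnected _ _
  · intro h
    have : Nonempty C.Chord := ⟨C.root hn⟩
    exact SimpleGraph.Connected.mk fun a b => (h a).symm.trans (h b)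

theorem intersectionOrder_of_connected {C : RootedChordDiagram n} (hC : C.Connected) (hn : 0 < n) :
    C.intersectionOrder = C.root hn ::
      componentwiseOrder C.intersectionGraph (Finset.univ.erase (C.root hn)) := by
  rw [intersectionOrder, componentwiseOrder_eq_cons _ (B := ∅) (Finset.mem_univ (C.root hn))
    (fun w _ => C.root_le hn w) (A := Finset.univ.erase (C.root hn)), componentwiseOrder_empty,
    List.append_nil]
  · intro w
    rw [componentIn_univ_of_connected _ hC, Finset.mem_erase]
  · intro w
    simp [componentIn_univ_of_connected _ hC]

theorem exists_word_eq_append_true (hn : 0 < n) : ∃ w, C.word = w ++ [true] := by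
  obtain ⟨l, c, h, hc⟩ := exists_componentwiseOrder_eq_append C.intersectionGraph
    (T := Finset.univ) ⟨C.root hn, Finset.mem_univ _⟩
  refine ⟨l.map (C.IsTerminal ·), ?_⟩
  rw [word, intersectionOrder, h, List.map_append]
  have : C.IsTerminal c := fun d hd => by
    rw [edge_iff_adj_and_lt] at hd
    exact hd.2.not_gt (hc d (Finset.mem_univ _) hd.1)
  rw [List.map_cons, List.map_nil, decide_eq_true this]

/-- Every position that separates the points of a connected diagram is straddled by a chord. -/
theorem exists_chord_straddling {C : RootedChordDiagram n} (hC : C.Connected) {g : ℕ}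
    (hg : g + 1 < 2 * n) : ∃ c : C.Chord, c.1.1 ≤ g ∧ g < (C.1 c.1).1 := by
  by_contra! H
  have hn : 0 < n := by omega
  -- If nothing straddles `g`, a chord starting by `g` also ends by `g`, so crossings starting from
  -- the root never lead past `g`; but the point `g + 1` lies on some chord.
  have key : ∀ c : C.Chord, c.1.1 ≤ g := fun c => by
    refine ((connected_iff C hn).1 hC c).induct (P := fun c => c.1.1 ≤ g) (Nat.zero_le _) ?_
    rintro a b ha (h | h)
    · exact (Nat.le_of_lt (Fin.lt_def.1 h.2.1)).trans (H a ha)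
    · exact (Nat.le_of_lt (Fin.lt_def.1 h.1)).trans ha
  have h1 := key (C.chordAt ⟨g + 1, hg⟩)
  have h2 := H _ h1
  rcases C.eq_or_eq_of_chordAt ⟨g + 1, hg⟩ with h | h
  · rw [← h] at h1
    simp at h1
  · rw [← h] at h2
    simp at h2

end RootedChordDiagram

/-! ### Gluing two diagrams at the root. -/

/-- The data for inserting a diagram with `m` chords into one with `k` chords: the points of the
former are split by a gap after its point `gap`, and all points of the latter but the root are put
into this gap, with the root in front of everything. -/
structure SplitShape (k m n : ℕ) where
  /-- The last point before the gap. -/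
  gap : ℕ
  pos : 0 < k
  gap_lt : gap + 1 < 2 * m
  add_eq : k + m = n

namespace SplitShape

variable {k m n : ℕ} (s : SplitShape k m n)

/-- The position of a point of the diagram containing the root. -/
def outer (x : Fin (2 * k)) : Fin (2 * n) :=
  ⟨if x.1 = 0 then 0 else x.1 + (s.gap + 1), by
    have := s.gap_lt; have := s.add_eq; have := x.2; split_ifs <;> omega⟩

/-- The position of a point of the inserted diagram. -/
def inner (x : Fin (2 * m)) : Fin (2 * n) :=
  ⟨if x.1 ≤ s.gap then x.1 + 1 else x.1 + 2 * k, by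
    have := s.pos; have := s.add_eq; have := x.2; split_ifs <;> omega⟩

theorem outer_val (x : Fin (2 * k)) :
    (s.outer x).1 = if x.1 = 0 then 0 else x.1 + (s.gap + 1) := rfl

theorem inner_val (x : Fin (2 * m)) :
    (s.inner x).1 = if x.1 ≤ s.gap then x.1 + 1 else x.1 + 2 * k := rfl

theorem outer_strictMono : StrictMono s.outer := fun x y h => by
  rw [Fin.lt_def] at h ⊢
  rw [outer_val, outer_val]
  split_ifs <;> omega

theorem inner_strictMono : StrictMono s.inner := fun x y h => by
  have := s.pos
  rw [Fin.lt_def] at h ⊢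
  rw [inner_val, inner_val]
  split_ifs <;> omega

theorem outer_ne_inner (x : Fin (2 * k)) (y : Fin (2 * m)) : s.outer x ≠ s.inner y := fun h => by
  have h := congrArg Fin.val h
  have := x.2
  rw [outer_val, inner_val] at h
  split_ifs at h <;> omega

theorem exists_outer {y : Fin (2 * n)}
    (h : y.1 = 0 ∨ s.gap + 1 < y.1 ∧ y.1 < s.gap + 1 + 2 * k) : ∃ x, y = s.outer x := by
  have := s.pos
  rcases h with h | h
  · exact ⟨⟨0, by omega⟩, Fin.ext (by rw [outer_val, h]; rfl)⟩
  · refine ⟨⟨y.1 - (s.gap + 1), by omega⟩, Fin.ext ?_⟩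
    rw [outer_val]
    simp only
    split_ifs <;> omega

theorem exists_inner {y : Fin (2 * n)}
    (h : 1 ≤ y.1 ∧ y.1 ≤ s.gap + 1 ∨ s.gap + 1 + 2 * k ≤ y.1) : ∃ x, y = s.inner x := by
  have := s.pos
  have := s.add_eq
  have := s.gap_lt
  have := y.2
  rcases h with h | h
  · refine ⟨⟨y.1 - 1, by omega⟩, Fin.ext ?_⟩
    rw [inner_val]
    simp only
    split_ifs <;> omega
  · refine ⟨⟨y.1 - 2 * k, by omega⟩, Fin.ext ?_⟩
    rw [inner_val]
    simp only
    split_ifs <;> omega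

theorem outer_or_inner (y : Fin (2 * n)) : (∃ x, y = s.outer x) ∨ ∃ x, y = s.inner x := by
  by_cases h : y.1 = 0 ∨ s.gap + 1 < y.1 ∧ y.1 < s.gap + 1 + 2 * k
  · exact Or.inl (s.exists_outer h)
  · exact Or.inr (s.exists_inner (by omega))

theorem inner_lt_outer_iff {x : Fin (2 * k)} (hx : x.1 ≠ 0) (y : Fin (2 * m)) :
    s.inner y < s.outer x ↔ y.1 ≤ s.gap := by
  have := x.2
  rw [Fin.lt_def, inner_val, outer_val]
  split_ifs <;> omega

theorem outer_lt_inner_iff {x : Fin (2 * k)} (hx : x.1 ≠ 0) (y : Fin (2 * m)) :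
    s.outer x < s.inner y ↔ s.gap < y.1 := by
  have := x.2
  rw [Fin.lt_def, inner_val, outer_val]
  split_ifs <;> omega

theorem mem_range_inner_iff (y : Fin (2 * n)) :
    (∃ x, y = s.inner x) ↔ 1 ≤ y.1 ∧ y.1 ≤ s.gap + 1 ∨ s.gap + 1 + 2 * k ≤ y.1 := by
  refine ⟨?_, s.exists_inner⟩
  rintro ⟨x, rfl⟩
  rw [inner_val]
  split_ifs <;> omega

end SplitShape

/-- `C` arises by inserting `D` into `R` according to the shape `s`. -/
structure IsSplit {k m n : ℕ} (s : SplitShape k m n) (C : RootedChordDiagram n)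
    (R : RootedChordDiagram k) (D : RootedChordDiagram m) : Prop where
  outer : ∀ x, C.1 (s.outer x) = s.outer (R.1 x)
  inner : ∀ x, C.1 (s.inner x) = s.inner (D.1 x)

theorem exists_isSplit {k m n : ℕ} (s : SplitShape k m n)
    (R : RootedChordDiagram k) (D : RootedChordDiagram m) : ∃ C, IsSplit s C R D := by
  have h : ∀ y : Fin (2 * n), ∃ z : Fin (2 * n), (∀ x, y = s.outer x → z = s.outer (R.1 x)) ∧
      ∀ x, y = s.inner x → z = s.inner (D.1 x) := by
    intro y
    rcases s.outer_or_inner y with ⟨x, rfl⟩ | ⟨x, rfl⟩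
    · refine ⟨s.outer (R.1 x), fun x' h => ?_, fun x' h => absurd h (s.outer_ne_inner _ _)⟩
      rw [s.outer_strictMono.injective h]
    · refine ⟨s.inner (D.1 x), fun x' h => absurd h.symm (s.outer_ne_inner _ _), fun x' h => ?_⟩
      rw [s.inner_strictMono.injective h]
  choose p hp1 hp2 using h
  have h1 : ∀ x, p (s.outer x) = s.outer (R.1 x) := fun x => hp1 _ x rfl
  have h2 : ∀ x, p (s.inner x) = s.inner (D.1 x) := fun x => hp2 _ x rfl
  refine ⟨⟨p, fun y => ?_, fun y => ?_⟩, h1, h2⟩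
  · rcases s.outer_or_inner y with ⟨x, rfl⟩ | ⟨x, rfl⟩
    · rw [h1, h1, R.partner_partner]
    · rw [h2, h2, D.partner_partner]
  · rcases s.outer_or_inner y with ⟨x, rfl⟩ | ⟨x, rfl⟩
    · rw [h1]
      exact fun h => R.partner_ne x (s.outer_strictMono.injective h)
    · rw [h2]
      exact fun h => D.partner_ne x (s.inner_strictMono.injective h)

namespace IsSplit

open RootedChordDiagram

variable {k m n : ℕ} {s : SplitShape k m n} {C : RootedChordDiagram n}
  {R : RootedChordDiagram k} {D : RootedChordDiagram m}

theorem unique (h : IsSplit s C R D) {C' : RootedChordDiagram n} (h' : IsSplit s C' R D) :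
    C = C' := by
  refine Subtype.ext (funext fun y => ?_)
  rcases s.outer_or_inner y with ⟨x, rfl⟩ | ⟨x, rfl⟩
  · exact (h.outer x).trans (h'.outer x).symm
  · exact (h.inner x).trans (h'.inner x).symm

theorem unique_parts (h : IsSplit s C R D) {R' : RootedChordDiagram k}
    {D' : RootedChordDiagram m} (h' : IsSplit s C R' D') : R = R' ∧ D = D' := by
  constructor <;> refine Subtype.ext (funext fun x => ?_)
  · exact s.outer_strictMono.injective ((h.outer x).symm.trans (h'.outer x))
  · exact s.inner_strictMono.injective ((h.inner x).symm.trans (h'.inner x))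

/-- The chords of the diagram containing the root, as chords of the whole diagram. -/
def outerChord (h : IsSplit s C R D) : R.Chord ↪o C.Chord :=
  OrderEmbedding.ofStrictMono
    (fun c => ⟨s.outer c.1, by rw [h.outer]; exact s.outer_strictMono c.2⟩)
    fun _ _ hcd => s.outer_strictMono hcd

/-- The chords of the inserted diagram, as chords of the whole diagram. -/
def innerChord (h : IsSplit s C R D) : D.Chord ↪o C.Chord :=
  OrderEmbedding.ofStrictMono
    (fun c => ⟨s.inner c.1, by rw [h.inner]; exact s.inner_strictMono c.2⟩)
    fun _ _ hcd => s.inner_strictMono hcd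

theorem outerChord_val (h : IsSplit s C R D) (c : R.Chord) : (h.outerChord c).1 = s.outer c.1 := rfl

theorem innerChord_val (h : IsSplit s C R D) (c : D.Chord) : (h.innerChord c).1 = s.inner c.1 := rfl

theorem outerChord_or_innerChord (h : IsSplit s C R D) (c : C.Chord) :
    (∃ r, c = h.outerChord r) ∨ ∃ d, c = h.innerChord d := by
  rcases s.outer_or_inner c.1 with ⟨x, hx⟩ | ⟨x, hx⟩
  · refine Or.inl ⟨⟨x, ?_⟩, Subtype.ext hx⟩
    have := c.2
    rw [hx, h.outer] at this
    exact s.outer_strictMono.lt_iff_lt.1 this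
  · refine Or.inr ⟨⟨x, ?_⟩, Subtype.ext hx⟩
    have := c.2
    rw [hx, h.inner] at this
    exact s.inner_strictMono.lt_iff_lt.1 this

theorem outerChord_ne_innerChord (h : IsSplit s C R D) (r : R.Chord) (d : D.Chord) :
    h.outerChord r ≠ h.innerChord d := fun e =>
  s.outer_ne_inner r.1 d.1 (congrArg Subtype.val e)

theorem edge_outerChord (h : IsSplit s C R D) (a b : R.Chord) :
    C.Edge (h.outerChord a) (h.outerChord b) ↔ R.Edge a b := by
  unfold Edge
  rw [outerChord_val, outerChord_val, h.outer, h.outer, s.outer_strictMono.lt_iff_lt,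
    s.outer_strictMono.lt_iff_lt, s.outer_strictMono.lt_iff_lt]

theorem edge_innerChord (h : IsSplit s C R D) (a b : D.Chord) :
    C.Edge (h.innerChord a) (h.innerChord b) ↔ D.Edge a b := by
  unfold Edge
  rw [innerChord_val, innerChord_val, h.inner, h.inner, s.inner_strictMono.lt_iff_lt,
    s.inner_strictMono.lt_iff_lt, s.inner_strictMono.lt_iff_lt]

theorem adj_outerChord (h : IsSplit s C R D) (a b : R.Chord) :
    C.intersectionGraph.Adj (h.outerChord a) (h.outerChord b) ↔ R.intersectionGraph.Adj a b :=
  or_congr (h.edge_outerChord a b) (h.edge_outerChord b a)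

theorem adj_innerChord (h : IsSplit s C R D) (a b : D.Chord) :
    C.intersectionGraph.Adj (h.innerChord a) (h.innerChord b) ↔ D.intersectionGraph.Adj a b :=
  or_congr (h.edge_innerChord a b) (h.edge_innerChord b a)

theorem outerChord_root (h : IsSplit s C R D) (hk : 0 < k) (hn : 0 < n) : h.outerChord (R.root hk)
    = C.root hn :=
  Subtype.ext (Fin.ext rfl)

/-- A chord of `R` other than the root has both endpoints in the same gap of `D`, so it cannot cross
a chord of `D`. -/
theorem eq_root_of_adj (h : IsSplit s C R D) (hk : 0 < k) {r : R.Chord} {d : D.Chord}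
    (hrd : C.intersectionGraph.Adj (h.outerChord r) (h.innerChord d)) : r = R.root hk := by
  by_contra hr
  have h0 : r.1.1 ≠ 0 := fun h0 => hr (Subtype.ext (Fin.ext h0))
  have h1 : (R.1 r.1).1 ≠ 0 := by
    have := Fin.lt_def.1 r.2
    omega
  rcases hrd with hrd | hrd
  · unfold Edge at hrd
    rw [outerChord_val, innerChord_val, h.outer, h.inner, s.outer_lt_inner_iff h0,
      s.inner_lt_outer_iff h1] at hrd
    omega
  · unfold Edge at hrd
    rw [outerChord_val, innerChord_val, h.outer, h.inner, s.inner_lt_outer_iff h0,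
      s.outer_lt_inner_iff h0, s.inner_lt_outer_iff h1] at hrd
    omega

/-- The root chord ends inside the gap, and some chord of the connected `D` straddles that gap. -/
theorem exists_edge_root (h : IsSplit s C R D) (hD : D.Connected) (hn : 0 < n) :
    ∃ d, C.Edge (C.root hn) (h.innerChord d) := by
  have hk := s.pos
  obtain ⟨d, hd1, hd2⟩ := exists_chord_straddling hD s.gap_lt
  refine ⟨d, ?_⟩
  rw [← h.outerChord_root hk hn]
  have h1 : (R.1 (R.root hk).1).1 ≠ 0 := Nat.ne_of_gt (Fin.lt_def.1 (R.root hk).2)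
  unfold Edge
  rw [outerChord_val, innerChord_val, h.outer, h.inner, s.inner_lt_outer_iff h1,
    s.outer_lt_inner_iff h1]
  refine ⟨Fin.lt_def.2 ?_, hd1, hd2⟩
  rw [s.outer_val, s.inner_val, if_pos (R.root_val hk), if_pos hd1]
  omega

theorem connected (h : IsSplit s C R D) (hR : R.Connected) (hD : D.Connected) : C.Connected := by
  have hk := s.pos
  have hn : 0 < n := by have := s.add_eq; omega
  rw [connected_iff C hn]
  obtain ⟨d0, hd0⟩ := h.exists_edge_root hD hn
  have h0 : C.intersectionGraph.Reachable (C.root hn) (h.innerChord d0) :=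
    SimpleGraph.Adj.reachable (Or.inl hd0)
  intro c
  rcases h.outerChord_or_innerChord c with ⟨r, rfl⟩ | ⟨d, rfl⟩
  · rw [← h.outerChord_root hk hn]
    refine ((connected_iff R hk).1 hR r).induct
      (P := fun r => C.intersectionGraph.Reachable (h.outerChord (R.root hk)) (h.outerChord r))
      (SimpleGraph.Reachable.refl _) fun a b ha hab => ?_
    exact ha.trans ((h.adj_outerChord a b).2 hab).reachable
  · refine (hD.preconnected d0 d).induct
      (P := fun d => C.intersectionGraph.Reachable (C.root hn) (h.innerChord d))
      h0 fun a b ha hab => ?_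
    exact ha.trans ((h.adj_innerChord a b).2 hab).reachable

theorem connected_outer (h : IsSplit s C R D) (hC : C.Connected) : R.Connected := by
  have hk := s.pos
  have hn : 0 < n := by have := s.add_eq; omega
  rw [connected_iff R hk]
  intro r
  -- A path may make detours through `D`, but it comes back to `R` only at the root; hence the claim
  -- is about outer chords only.
  have key := ((connected_iff C hn).1 hC (h.outerChord r)).induct
    (P := fun c => ∀ r, c = h.outerChord r → R.intersectionGraph.Reachable (R.root hk) r) ?_ ?_
  · exact key r rfl
  · intro r hr
    rw [← h.outerChord_root hk hn] at hr
    rw [h.outerChord.injective hr]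
  · rintro a b ha hab r rfl
    rcases h.outerChord_or_innerChord a with ⟨r', rfl⟩ | ⟨d, rfl⟩
    · exact (ha r' rfl).trans ((h.adj_outerChord _ _).1 hab).reachable
    · rw [h.eq_root_of_adj hk hab.symm]

theorem innerChord_ne_root (h : IsSplit s C R D) (hn : 0 < n) (d : D.Chord) :
    h.innerChord d ≠ C.root hn := by
  rw [← h.outerChord_root s.pos hn]
  exact (h.outerChord_ne_innerChord _ _).symm

theorem componentIn_innerChord (h : IsSplit s C R D) (hD : D.Connected) (hn : 0 < n) (d : D.Chord) :
    componentIn C.intersectionGraph (Finset.univ.erase (C.root hn)) (h.innerChord d) =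
      Finset.univ.map h.innerChord.toEmbedding := by
  apply componentIn_eq
  · exact Finset.mem_map_of_mem h.innerChord.toEmbedding (Finset.mem_univ d)
  · intro a ha b hb hab
    obtain ⟨a, -, rfl⟩ := Finset.mem_map.1 ha
    rcases h.outerChord_or_innerChord b with ⟨r, rfl⟩ | ⟨d, rfl⟩
    · have hr := h.eq_root_of_adj s.pos hab.symm
      rw [hr, h.outerChord_root s.pos hn] at hb
      exact absurd rfl (Finset.mem_erase.1 hb).1
    · exact Finset.mem_map_of_mem h.innerChord.toEmbedding (Finset.mem_univ d)
  · intro w hw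
    obtain ⟨w, -, rfl⟩ := Finset.mem_map.1 hw
    have hmem : ∀ d, h.innerChord d ∈ Finset.univ.erase (C.root hn) := fun d =>
      Finset.mem_erase.2 ⟨h.innerChord_ne_root hn d, Finset.mem_univ _⟩
    refine (hD.preconnected d w).induct (P := fun w => h.innerChord w ∈
      componentIn C.intersectionGraph (Finset.univ.erase (C.root hn)) (h.innerChord d))
      (self_mem_componentIn _ (hmem d)) fun a b ha hab => ?_
    exact mem_componentIn_of_adj _ ha (hmem b) ((h.adj_innerChord a b).2 hab)

theorem innerChord_root_le (h : IsSplit s C R D) (hm : 0 < m) (hn : 0 < n) (c : C.Chord)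
    (hc : c ≠ C.root hn) :
    h.innerChord (D.root hm) ≤ c := by
  have h0 : c.1.1 ≠ 0 := fun h0 => hc (Subtype.ext (Fin.ext h0))
  have h1 : (h.innerChord (D.root hm)).1.1 = 1 := by
    rw [innerChord_val, s.inner_val, root_val, if_pos (Nat.zero_le _)]
  exact Fin.le_def.2 (by omega)

/-- `D` owns the point next to the root, so once the root is deleted its component is listed first;
what remains is `R` without its root. -/
theorem intersectionOrder_eq (h : IsSplit s C R D) (hR : R.Connected) (hD : D.Connected)
    (hk : 0 < k) (hn : 0 < n) :
    C.intersectionOrder = C.root hn :: (D.intersectionOrder.map h.innerChord ++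
      (componentwiseOrder R.intersectionGraph (Finset.univ.erase (R.root hk))).map
        h.outerChord) := by
  have hm := pos_of_connected hD
  rw [intersectionOrder_of_connected (h.connected hR hD) hn,
    componentwiseOrder_eq_cons C.intersectionGraph (T := Finset.univ.erase (C.root hn))
    (A := (Finset.univ.erase (D.root hm)).map h.innerChord.toEmbedding)
    (B := (Finset.univ.erase (R.root hk)).map h.outerChord.toEmbedding)
    (u := h.innerChord (D.root hm))
    (Finset.mem_erase.2 ⟨h.innerChord_ne_root hn _, Finset.mem_univ _⟩)
    (fun w hw => h.innerChord_root_le hm hn w (Finset.mem_erase.1 hw).1),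
    intersectionOrder_of_connected hD hm, componentwiseOrder_map _ _ _ h.adj_innerChord,
    componentwiseOrder_map _ _ _ h.adj_outerChord]
  · rfl
  · intro c
    rw [h.componentIn_innerChord hD hn, Finset.mem_map, Finset.mem_map]
    constructor
    · rintro ⟨d, hd, rfl⟩
      exact ⟨fun e => (Finset.mem_erase.1 hd).1 (h.innerChord.injective e), d, Finset.mem_univ _,
        rfl⟩
    · rintro ⟨hne, d, -, rfl⟩
      exact ⟨d, Finset.mem_erase.2 ⟨fun e => hne (congrArg _ e), Finset.mem_univ _⟩, rfl⟩
  · intro c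
    rw [h.componentIn_innerChord hD hn, Finset.mem_erase, Finset.mem_map, Finset.mem_map]
    constructor
    · rintro ⟨r, hr, rfl⟩
      refine ⟨⟨fun hc => (Finset.mem_erase.1 hr).1 (h.outerChord.injective ?_),
        Finset.mem_univ _⟩, ?_⟩
      · rw [h.outerChord_root hk hn]
        exact hc
      · rintro ⟨d, -, hd⟩
        exact h.outerChord_ne_innerChord r d hd.symm
    · rintro ⟨⟨hc, -⟩, hc'⟩
      rcases h.outerChord_or_innerChord c with ⟨r, rfl⟩ | ⟨d, rfl⟩
      · refine ⟨r, Finset.mem_erase.2 ⟨?_, Finset.mem_univ _⟩, rfl⟩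
        rintro rfl
        exact hc (h.outerChord_root hk hn)
      · exact absurd ⟨d, Finset.mem_univ _, rfl⟩ hc'

theorem isTerminal_innerChord (h : IsSplit s C R D) (d : D.Chord) : C.IsTerminal (h.innerChord d)
    ↔ D.IsTerminal d := by
  constructor
  · intro hd d' hdd'
    exact hd _ ((h.edge_innerChord d d').2 hdd')
  · intro hd c hc
    rcases h.outerChord_or_innerChord c with ⟨r, rfl⟩ | ⟨d', rfl⟩
    · have hr := h.eq_root_of_adj s.pos (Or.inr hc)
      have := hc.1
      rw [hr, outerChord_val, Fin.lt_def, s.outer_val, root_val, if_pos rfl] at this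
      exact absurd this (Nat.not_lt_zero _)
    · exact hd _ ((h.edge_innerChord d d').1 hc)

theorem isTerminal_outerChord (h : IsSplit s C R D) (hk : 0 < k) {r : R.Chord} (hr : r ≠ R.root hk)
    :
    C.IsTerminal (h.outerChord r) ↔ R.IsTerminal r := by
  constructor
  · intro hd d' hdd'
    exact hd _ ((h.edge_outerChord r d').2 hdd')
  · intro hd c hc
    rcases h.outerChord_or_innerChord c with ⟨r', rfl⟩ | ⟨d', rfl⟩
    · exact hd _ ((h.edge_outerChord r r').1 hc)
    · exact hr (h.eq_root_of_adj hk (Or.inl hc))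

/-- Crossing `D` makes the root nonterminal in `C`; all other chords keep their status, as only the
root crosses between `R` and `D`. The case split is needed because the root of a one-chord `R` is
terminal in `R`. -/
theorem word_eq (h : IsSplit s C R D) (hR : R.Connected) (hD : D.Connected) :
    ∃ v, C.word = false :: (D.word ++ v) ∧
      (v = [] ∧ R.word = [true] ∨ v ≠ [] ∧ R.word = false :: v) := by
  have hk := s.pos
  have hn : 0 < n := by have := s.add_eq; omega
  refine ⟨(componentwiseOrder R.intersectionGraph (Finset.univ.erase (R.root hk))).map
    (R.IsTerminal ·), ?_, ?_⟩
  · obtain ⟨d, hd⟩ := h.exists_edge_root hD hn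
    have h0 : ¬ C.IsTerminal (C.root hn) := fun ht => ht _ hd
    rw [word, h.intersectionOrder_eq hR hD hk hn, List.map_cons, List.map_append, List.map_map,
      List.map_map, decide_eq_false h0, word]
    congr 2
    · refine List.map_congr_left fun d _ => ?_
      exact decide_eq_decide.2 (h.isTerminal_innerChord d)
    · refine List.map_congr_left fun r hr => ?_
      rw [mem_componentwiseOrder, Finset.mem_erase] at hr
      exact decide_eq_decide.2 (h.isTerminal_outerChord hk hr.1)
  · rw [word, intersectionOrder_of_connected hR hk, List.map_cons]
    rcases (Finset.univ.erase (R.root hk)).eq_empty_or_nonempty with he | ⟨r, hr⟩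
    · left
      have ht : R.IsTerminal (R.root hk) := fun r hr => by
        have : r ∈ Finset.univ.erase (R.root hk) :=
          Finset.mem_erase.2 ⟨fun e => (e ▸ hr.1).false, Finset.mem_univ _⟩
        rw [he] at this
        exact Finset.notMem_empty _ this
      rw [he, componentwiseOrder_empty, decide_eq_true ht]
      exact ⟨rfl, rfl⟩
    · right
      have ht : ¬ R.IsTerminal (R.root hk) := fun ht => by
        refine (Finset.mem_erase.1 hr).1 (((connected_iff R hk).1 hR r).induct
          (P := fun r => r = R.root hk) rfl ?_)
        rintro a b rfl hab
        by_contra hb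
        exact ht b ((R.edge_iff_adj_and_lt).2 ⟨hab, lt_of_le_of_ne (R.root_le hk b) (Ne.symm hb)⟩)
      rw [decide_eq_false ht]
      refine ⟨fun e => ?_, rfl⟩
      rw [List.map_eq_nil_iff] at e
      have := (mem_componentwiseOrder R.intersectionGraph).2 hr
      rw [e] at this
      exact List.not_mem_nil this

theorem b_eq_add_one (h : IsSplit s C R D) (hR : R.Connected) (hD : D.Connected) :
    C.b = D.b + 1 := by
  obtain ⟨v, hv, -⟩ := h.word_eq hR hD
  obtain ⟨u, hu⟩ := D.exists_word_eq_append_true (pos_of_connected hD)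
  rw [C.b_eq, D.b_eq, hv, hu, firstTrue_false_cons_append]

/-- The factor `f (R.b - 1)` is the gap between the last chord of `D` and the first terminal chord
of the rest of `R`. For a one-chord `R` there is no such gap, and the factor is the `f 0` of the now
nonterminal root. -/
theorem monomial_eq_mul (h : IsSplit s C R D) {A : Type*} [CommSemiring A] (f : ℕ → A)
    (hR : R.Connected)
    (hD : D.Connected) :
    C.monomial f = R.monomial f * f (R.b - 1) * D.monomial f := by
  obtain ⟨v, hv, hv'⟩ := h.word_eq hR hD
  obtain ⟨u, hu⟩ := D.exists_word_eq_append_true (pos_of_connected hD)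
  obtain ⟨w, hw⟩ := R.exists_word_eq_append_true (pos_of_connected hR)
  rw [C.monomial_eq, D.monomial_eq, R.monomial_eq, R.b_eq, hv, hu]
  rcases hv' with ⟨rfl, hR'⟩ | ⟨hne, hR'⟩
  · rw [hR', List.append_nil, wordMonomial_false_cons, wordMonomial_singleton_true,
      firstTrue_singleton_true, one_mul]
  · obtain ⟨w', rfl⟩ : ∃ w', v = w' ++ [true] := by
      rw [hR'] at hw
      cases w with
      | nil => simp at hw
      | cons b w => exact ⟨w, (List.cons.inj hw).2⟩
    have hf : firstTrue (false :: (w' ++ [true])) - 1 = firstTrue (w' ++ [true]) := by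
      have := firstTrue_false_cons_append w' []
      rw [List.append_nil] at this
      omega
    have e : false :: (u ++ [true] ++ (w' ++ [true])) =
        false :: ((u ++ [true] ++ w') ++ [true]) := by simp
    rw [hR', e, wordMonomial_false_cons, wordMonomial_false_cons, hf, List.append_assoc,
      wordMonomial_append]
    ring

/-- The points of the inserted diagram are those of the first component left by deleting the root, a
set that depends on `C` only. -/
theorem shape_eq (h : IsSplit s C R D) {k' m' : ℕ} {s' : SplitShape k' m' n}
    {R' : RootedChordDiagram k'}
    {D' : RootedChordDiagram m'} (h' : IsSplit s' C R' D') (hD : D.Connected)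
    (hD' : D'.Connected) : k = k' ∧ s.gap = s'.gap := by
  have hn : 0 < n := by have := s.add_eq; have := s.pos; omega
  have hm := pos_of_connected hD
  have hm' := pos_of_connected hD'
  have hroot : h.innerChord (D.root hm) = h'.innerChord (D'.root hm') :=
    le_antisymm (h.innerChord_root_le hm hn _ (h'.innerChord_ne_root hn _))
      (h'.innerChord_root_le hm' hn _ (h.innerChord_ne_root hn _))
  have hK : Finset.univ.map h.innerChord.toEmbedding =
      Finset.univ.map h'.innerChord.toEmbedding := by
    rw [← h.componentIn_innerChord hD hn (D.root hm), hroot, h'.componentIn_innerChord hD' hn]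
  have hmem : ∀ {k m : ℕ} {s : SplitShape k m n} {R : RootedChordDiagram k}
      {D : RootedChordDiagram m} (h : IsSplit s C R D) (y : Fin (2 * n)),
      C.chordAt y ∈ Finset.univ.map h.innerChord.toEmbedding ↔ ∃ x, y = s.inner x := by
    intro k m s R D h y
    rw [Finset.mem_map]
    constructor
    · rintro ⟨d, -, hd⟩
      have hd' : s.inner d.1 = (C.chordAt y).1 := congrArg Subtype.val hd
      rcases C.eq_or_eq_of_chordAt y with hy | hy
      · exact ⟨d.1, hy.trans hd'.symm⟩
      · exact ⟨D.1 d.1, by rw [← h.inner, hd', ← hy]⟩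
    · rintro ⟨x, rfl⟩
      rcases h.outerChord_or_innerChord (C.chordAt (s.inner x)) with ⟨r, hr⟩ | ⟨d, hd⟩
      · exfalso
        rcases C.eq_or_eq_of_chordAt (s.inner x) with hy | hy
        · rw [hr] at hy
          exact s.outer_ne_inner r.1 x hy.symm
        · rw [hr, outerChord_val, h.outer] at hy
          exact s.outer_ne_inner _ x hy.symm
      · exact ⟨d, Finset.mem_univ _, hd.symm⟩
  have hiff : ∀ y : ℕ, y < 2 * n → ((1 ≤ y ∧ y ≤ s.gap + 1 ∨ s.gap + 1 + 2 * k ≤ y) ↔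
      (1 ≤ y ∧ y ≤ s'.gap + 1 ∨ s'.gap + 1 + 2 * k' ≤ y)) := fun y hy => by
    rw [← s.mem_range_inner_iff ⟨y, hy⟩, ← s'.mem_range_inner_iff ⟨y, hy⟩, ← hmem h, ← hmem h', hK]
  -- The test points are the first one inside and the first one after each of the two gaps.
  have h1 := hiff (s.gap + 2)
  have h2 := hiff (s'.gap + 2)
  have h3 := hiff (s.gap + 1 + 2 * k)
  have h4 := hiff (s'.gap + 1 + 2 * k')
  have := s.pos
  have := s'.pos
  have := s.gap_lt
  have := s'.gap_lt
  have := s.add_eq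
  have := s'.add_eq
  omega

end IsSplit

/-! ### Decomposing a connected diagram. -/

theorem even_card_of_involution {α : Type*} (S : Finset α) (p : α → α) (hp : ∀ x, p (p x) = x)
    (hne : ∀ x, p x ≠ x) (hS : ∀ x ∈ S, p x ∈ S) : Even S.card := by
  rw [← ZMod.natCast_eq_zero_iff_even]
  have : ∑ _x ∈ S, (1 : ZMod 2) = 0 :=
    Finset.sum_involution (fun x _ => p x) (fun _ _ => by decide) (fun x _ _ => hne x)
      (fun x hx => hS x hx) (fun x _ => hp x)
  simpa using this

namespace RootedChordDiagram

variable {n : ℕ} {C : RootedChordDiagram n}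

theorem edge_iff_val {c d : C.Chord} :
    C.Edge c d ↔ c.1.1 < d.1.1 ∧ d.1.1 < (C.1 c.1).1 ∧ (C.1 c.1).1 < (C.1 d.1).1 := Iff.rfl

theorem endpoints_ne {c d : C.Chord} (h : c ≠ d) :
    c.1.1 ≠ d.1.1 ∧ c.1.1 ≠ (C.1 d.1).1 ∧ (C.1 c.1).1 ≠ d.1.1 ∧ (C.1 c.1).1 ≠ (C.1 d.1).1 := by
  have aux : ∀ c d : C.Chord, c.1.1 ≠ (C.1 d.1).1 := fun c d e => by
    have hc := c.2
    rw [Fin.ext e, C.partner_partner] at hc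
    exact hc.not_gt d.2
  refine ⟨fun e => h (Subtype.ext (Fin.ext e)), aux c d, (aux d c).symm, fun e => h ?_⟩
  exact Subtype.ext (C.partner_injective (Fin.ext e))

/-- A root chord ending at the next point would cross nothing, hence be the only chord, leaving the
third point unmatched. -/
theorem one_lt_partner (hC : C.Connected) (hn : 2 ≤ n) :
    (⟨1, by omega⟩ : Fin (2 * n)) < C.1 ⟨1, by omega⟩ := by
  have hn0 : 0 < n := by omega
  by_contra H
  have h1 : C.1 ⟨1, by omega⟩ = rootPoint hn0 := by
    have hlt := lt_of_le_of_ne (not_lt.1 H) (C.partner_ne _)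
    exact Fin.ext (Nat.lt_one_iff.1 (Fin.lt_def.1 hlt))
  have h0 : (C.1 (C.root hn0).1).1 = 1 := by
    have := C.partner_partner ⟨1, by omega⟩
    rw [h1] at this
    exact congrArg Fin.val this
  have key : ∀ c, c = C.root hn0 := fun c => by
    refine ((connected_iff C hn0).1 hC c).induct (P := fun c => c = C.root hn0) rfl ?_
    rintro a b rfl (h | h) <;> rw [edge_iff_val] at h <;>
      have := C.root_val hn0 <;> omega
  rcases C.eq_or_eq_of_chordAt ⟨2, by omega⟩ with h | h
  · rw [key (C.chordAt _)] at h
    exact absurd (congrArg Fin.val h) (by simp [root_val])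
  · rw [key (C.chordAt _)] at h
    have := congrArg Fin.val h
    rw [h0] at this
    simp at this

/-- The chord at the second point of a connected diagram. -/
def secondChord (hC : C.Connected) (hn : 2 ≤ n) : C.Chord := ⟨⟨1, by omega⟩, one_lt_partner hC hn⟩

/-- The first component that is left when the root chord is deleted. -/
def firstComponent (hC : C.Connected) (hn : 2 ≤ n) : Finset C.Chord :=
  componentIn C.intersectionGraph (Finset.univ.erase (C.root (by omega))) (secondChord hC hn)

section FirstComponent

variable (hC : C.Connected) (hn : 2 ≤ n)

theorem secondChord_mem : secondChord hC hn ∈ firstComponent hC hn := by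
  refine self_mem_componentIn _ (Finset.mem_erase.2 ⟨fun h => ?_, Finset.mem_univ _⟩)
  exact absurd (congrArg (fun c : C.Chord => c.1.1) h) one_ne_zero

theorem root_notMem (hn0 : 0 < n) : C.root hn0 ∉ firstComponent hC hn := fun h =>
  (Finset.mem_erase.1 (componentIn_subset _ _ _ h)).1 rfl

theorem mem_firstComponent_of_adj (hn0 : 0 < n) {a b : C.Chord} (ha : a ∈ firstComponent hC hn)
    (hb : b ≠ C.root hn0) (h : C.intersectionGraph.Adj a b) : b ∈ firstComponent hC hn :=
  mem_componentIn_of_adj _ ha (Finset.mem_erase.2 ⟨hb, Finset.mem_univ _⟩) h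

theorem firstComponent_induct {P : C.Chord → Prop} {a : C.Chord} (ha : a ∈ firstComponent hC hn)
    (h0 : P (secondChord hC hn)) (hP : ∀ a ∈ firstComponent hC hn, ∀ b ∈ firstComponent hC hn,
      P a → C.intersectionGraph.Adj a b → P b) : P a := by
  refine (componentIn_induct C.intersectionGraph (P := fun a => a ∈ firstComponent hC hn ∧ P a) ha
    ⟨secondChord_mem hC hn, h0⟩ ?_).2
  rintro a b ⟨ha, hPa⟩ _ hb hab
  have hbK := mem_firstComponent_of_adj hC hn (by omega) ha (Finset.mem_erase.1 hb).1 hab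
  exact ⟨hbK, hP a ha b hbK hPa hab⟩

/-- No endpoint of the first component lies between the endpoints of another chord. -/
theorem firstComponent_outside (hn0 : 0 < n) {c : C.Chord} (hc : c ∉ firstComponent hC hn)
    (hc0 : c ≠ C.root hn0) {a : C.Chord} (ha : a ∈ firstComponent hC hn) :
    ¬ (c.1.1 < a.1.1 ∧ a.1.1 < (C.1 c.1).1) ∧
      ¬ (c.1.1 < (C.1 a.1).1 ∧ (C.1 a.1).1 < (C.1 c.1).1) := by
  have hnot : ∀ a ∈ firstComponent hC hn, ¬ C.Edge a c ∧ ¬ C.Edge c a := fun a ha =>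
    ⟨fun h => hc (mem_firstComponent_of_adj hC hn hn0 ha hc0 (Or.inl h)),
      fun h => hc (mem_firstComponent_of_adj hC hn hn0 ha hc0 (Or.inr h))⟩
  have hc00 : c.1.1 ≠ 0 := fun h => hc0 (Subtype.ext (Fin.ext h))
  refine firstComponent_induct hC hn (P := fun a => ¬ (c.1.1 < a.1.1 ∧ a.1.1 < (C.1 c.1).1) ∧
      ¬ (c.1.1 < (C.1 a.1).1 ∧ (C.1 a.1).1 < (C.1 c.1).1)) ha ?_ ?_
  -- The second point precedes both endpoints of `c`, so its chord lies outside `c` unless it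
  -- crosses `c`. Crossings within the component then never lead inside.
  · have h1 := (hnot _ (secondChord_mem hC hn)).1
    rw [edge_iff_val] at h1
    have h2 : (secondChord hC hn).1.1 = 1 := rfl
    have h3 := (endpoints_ne (fun h => hc (h ▸ secondChord_mem hC hn) : c ≠ secondChord hC hn)).1
    omega
  · intro a ha b hb hPa hab
    have h1 := hnot b hb
    have h2 := endpoints_ne (fun h => hc (h ▸ hb) : c ≠ b)
    have h3 := Fin.lt_def.1 a.2
    have h4 := Fin.lt_def.1 b.2
    have h5 := Fin.lt_def.1 c.2
    have h6 : C.Edge a b ∨ C.Edge b a := hab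
    simp only [edge_iff_val] at h1 h6
    omega

/-- All other chords lie, with respect to the first component, on the same side as the second
endpoint of the root chord. -/
theorem firstComponent_side (hn0 : 0 < n) {c : C.Chord} (hc : c ∉ firstComponent hC hn)
    (hc0 : c ≠ C.root hn0) {a : C.Chord} (ha : a ∈ firstComponent hC hn) :
    ((a.1.1 < c.1.1 ↔ a.1.1 < (C.1 (C.root hn0).1).1) ∧
      (a.1.1 < (C.1 c.1).1 ↔ a.1.1 < (C.1 (C.root hn0).1).1)) ∧
    (((C.1 a.1).1 < c.1.1 ↔ (C.1 a.1).1 < (C.1 (C.root hn0).1).1) ∧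
      ((C.1 a.1).1 < (C.1 c.1).1 ↔ (C.1 a.1).1 < (C.1 (C.root hn0).1).1)) := by
  refine ((connected_iff C hn0).1 hC c).induct (P := fun c => c ∉ firstComponent hC hn →
    c ≠ C.root hn0 → ((a.1.1 < c.1.1 ↔ a.1.1 < (C.1 (C.root hn0).1).1) ∧
      (a.1.1 < (C.1 c.1).1 ↔ a.1.1 < (C.1 (C.root hn0).1).1)) ∧
    (((C.1 a.1).1 < c.1.1 ↔ (C.1 a.1).1 < (C.1 (C.root hn0).1).1) ∧
      ((C.1 a.1).1 < (C.1 c.1).1 ↔ (C.1 a.1).1 < (C.1 (C.root hn0).1).1)))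
    (fun _ h => absurd rfl h) ?_ hc hc0
  -- No endpoint of the component lies between the ends of `e`, and `e` crosses `d`, so both lie in
  -- the same gap of the component. If `d` is the root, `e` surrounds its second endpoint.
  intro d e hPd hde he he0
  have h1 := firstComponent_outside hC hn hn0 he he0 ha
  have h2 := endpoints_ne (fun h => he (h ▸ ha) : e ≠ a)
  have h3 := Fin.lt_def.1 e.2
  have h6 : C.Edge d e ∨ C.Edge e d := hde
  simp only [edge_iff_val] at h6
  by_cases hd0 : d = C.root hn0
  · subst hd0
    have := C.root_val hn0
    omega
  · have hd : d ∉ firstComponent hC hn := fun hd =>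
      he (mem_firstComponent_of_adj hC hn hn0 hd he0 hde)
    have h4 := hPd hd hd0
    have h5 := endpoints_ne (fun h => hd (h ▸ ha) : d ≠ a)
    have h7 := Fin.lt_def.1 d.2
    have h8 := firstComponent_outside hC hn hn0 hd hd0 ha
    omega

theorem exists_edge_root_firstComponent (hn0 : 0 < n) :
    ∃ a ∈ firstComponent hC hn, C.Edge (C.root hn0) a := by
  by_contra! H
  refine root_notMem hC hn hn0 ((hC.preconnected (secondChord hC hn) (C.root hn0)).induct
    (P := fun c => c ∈ firstComponent hC hn) (secondChord_mem hC hn) ?_)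
  intro a b ha hab
  refine mem_firstComponent_of_adj hC hn hn0 ha (fun hb => H a ha ?_) hab
  subst hb
  rw [edge_iff_adj_and_lt]
  exact ⟨hab.symm, lt_of_le_of_ne (C.root_le hn0 a) hab.ne'⟩

theorem lt_iff_lt_of_chordAt (hn0 : 0 < n) {y z : Fin (2 * n)} (hy0 : y.1 ≠ 0)
    (hy : C.chordAt y ∉ firstComponent hC hn) (hz : C.chordAt z ∈ firstComponent hC hn) :
    z.1 < y.1 ↔ z.1 < (C.1 (C.root hn0).1).1 := by
  by_cases h0 : C.chordAt y = C.root hn0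
  · rcases C.eq_or_eq_of_chordAt y with h | h
    · rw [h0] at h
      exact absurd (congrArg Fin.val h) hy0
    · rw [h0] at h
      rw [h]
  · have key := firstComponent_side hC hn hn0 hy h0 hz
    rcases C.eq_or_eq_of_chordAt y with h | h <;> rcases C.eq_or_eq_of_chordAt z with h' | h' <;>
      rw [← h, ← h'] at key <;> tauto

/-- The points of the first component are those outside some interval, and different from the
root. -/
theorem exists_interval (hn0 : 0 < n) : ∃ a b, 1 ≤ a ∧ a < b ∧ b < 2 * n ∧ Even (b - a) ∧
    ∀ y : Fin (2 * n),
      C.chordAt y ∈ firstComponent hC hn ↔ 1 ≤ y.1 ∧ y.1 ≤ a ∨ b ≤ y.1 := by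
  classical
  -- A chord of the component crossing the root has endpoints on both sides of the root's second
  -- endpoint; `a` and `b` are the nearest points of the component on each side.
  obtain ⟨c, hcK, hc⟩ := exists_edge_root_firstComponent hC hn hn0
  rw [edge_iff_val] at hc
  have hzr : ∀ z, C.chordAt z ∈ firstComponent hC hn → z.1 ≠ (C.1 (C.root hn0).1).1 ∧ z.1 ≠ 0 := by
    intro z hz
    constructor
    · intro h
      rw [Fin.ext h, chordAt_partner, chordAt_chord] at hz
      exact root_notMem hC hn hn0 hz
    · intro h
      have : z = (C.root hn0).1 := Fin.ext h
      rw [this, chordAt_chord] at hz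
      exact root_notMem hC hn hn0 hz
  obtain ⟨a, ha, hamax⟩ := Finset.exists_max_image (Finset.univ.filter fun z : Fin (2 * n) =>
    C.chordAt z ∈ firstComponent hC hn ∧ z.1 < (C.1 (C.root hn0).1).1) Fin.val
    ⟨c.1, Finset.mem_filter.2 ⟨Finset.mem_univ _, by rwa [chordAt_chord], hc.2.1⟩⟩
  obtain ⟨b, hb, hbmin⟩ := Finset.exists_min_image (Finset.univ.filter fun z : Fin (2 * n) =>
    C.chordAt z ∈ firstComponent hC hn ∧ (C.1 (C.root hn0).1).1 < z.1) Fin.val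
    ⟨C.1 c.1, Finset.mem_filter.2 ⟨Finset.mem_univ _, by rwa [chordAt_partner, chordAt_chord],
      hc.2.2⟩⟩
  rw [Finset.mem_filter] at ha hb
  have hmem : ∀ y : Fin (2 * n),
      C.chordAt y ∈ firstComponent hC hn ↔ 1 ≤ y.1 ∧ y.1 ≤ a.1 ∨ b.1 ≤ y.1 := by
    intro y
    constructor
    · intro hy
      have := hzr y hy
      rcases lt_or_gt_of_ne this.1 with h | h
      · have := hamax y (Finset.mem_filter.2 ⟨Finset.mem_univ _, hy, h⟩)
        omega
      · have := hbmin y (Finset.mem_filter.2 ⟨Finset.mem_univ _, hy, h⟩)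
        omega
    · intro hy
      by_contra hyK
      have h1 := lt_iff_lt_of_chordAt hC hn hn0 (by omega) hyK ha.2.1
      have h2 := lt_iff_lt_of_chordAt hC hn hn0 (by omega) hyK hb.2.1
      have h3 : b.1 ≠ y.1 := fun h => hyK (Fin.ext h ▸ hb.2.1)
      omega
  refine ⟨a.1, b.1, ?_, by omega, b.2, ?_, hmem⟩
  · have := hzr a ha.2.1
    omega
  -- The remaining points are the root and those strictly between `a` and `b`, in all `b - a`, and
  -- they are matched among themselves.
  · have heven := even_card_of_involution
      (Finset.univ.filter fun y => C.chordAt y ∉ firstComponent hC hn) C.1 C.partner_partner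
      C.partner_ne (fun y hy => by
        rw [Finset.mem_filter] at hy ⊢
        rw [chordAt_partner]
        exact ⟨Finset.mem_univ _, hy.2⟩)
    have hcard : (Finset.univ.filter fun y => C.chordAt y ∉ firstComponent hC hn).map
        Fin.valEmbedding = insert 0 (Finset.Ioo a.1 b.1) := by
      ext y
      rw [Finset.mem_map, Finset.mem_insert, Finset.mem_Ioo]
      constructor
      · rintro ⟨y, hy, rfl⟩
        rw [Finset.mem_filter, hmem] at hy
        rw [Fin.valEmbedding_apply]
        omega
      · intro hy
        have := b.2
        refine ⟨⟨y, by omega⟩, ?_, rfl⟩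
        rw [Finset.mem_filter, hmem]
        refine ⟨Finset.mem_univ _, ?_⟩
        simp only
        omega
    rw [← Finset.card_map Fin.valEmbedding, hcard, Finset.card_insert_of_notMem (by simp),
      Nat.card_Ioo] at heven
    convert heven using 1
    omega

theorem exists_split (hC : C.Connected) (hn : 2 ≤ n) :
    ∃ (k m : ℕ) (s : SplitShape k m n) (R : RootedChordDiagram k) (D : RootedChordDiagram m),
      IsSplit s C R D ∧ R.Connected ∧ D.Connected := by
  have hn0 : 0 < n := by omega
  obtain ⟨a, b, ha, hab, hb, ⟨k, hk⟩, hmem⟩ := exists_interval hC hn hn0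
  -- The gap is `a - 1` because the root in front shifts the points of the inserted diagram by one.
  let s : SplitShape k (n - k) n := ⟨a - 1, by omega, by omega, by omega⟩
  have hin : ∀ y, C.chordAt y ∈ firstComponent hC hn ↔ ∃ x, y = s.inner x := by
    intro y
    rw [s.mem_range_inner_iff, hmem]
    change _ ↔ 1 ≤ y.1 ∧ y.1 ≤ a - 1 + 1 ∨ a - 1 + 1 + 2 * k ≤ y.1
    omega
  have hout : ∀ x, ∃ y, C.1 (s.outer x) = s.outer y := fun x => by
    refine (s.outer_or_inner _).resolve_right fun h => ?_
    rw [← hin, chordAt_partner, hin] at h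
    obtain ⟨y, hy⟩ := h
    exact s.outer_ne_inner _ _ hy
  have hinn : ∀ x, ∃ y, C.1 (s.inner x) = s.inner y := fun x => by
    rw [← hin, chordAt_partner, hin]
    exact ⟨x, rfl⟩
  choose p hp using hout
  choose q hq using hinn
  let R : RootedChordDiagram k := ⟨p, fun x => s.outer_strictMono.injective (by
    rw [← hp, ← hp, C.partner_partner]), fun x h => C.partner_ne (s.outer x) (by rw [hp, h])⟩
  let D : RootedChordDiagram (n - k) := ⟨q, fun x => s.inner_strictMono.injective (by
    rw [← hq, ← hq, C.partner_partner]), fun x h => C.partner_ne (s.inner x) (by rw [hq, h])⟩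
  have h : IsSplit s C R D := ⟨hp, hq⟩
  refine ⟨k, n - k, s, R, D, h, h.connected_outer hC, ?_⟩
  have hm : 0 < n - k := by have := s.gap_lt; omega
  rw [connected_iff D hm]
  intro d
  have hd : h.innerChord d ∈ firstComponent hC hn := by
    rw [← C.chordAt_chord (h.innerChord d), hin]
    exact ⟨d.1, rfl⟩
  refine firstComponent_induct hC hn (P := fun c => ∀ d, c = h.innerChord d →
    D.intersectionGraph.Reachable (D.root hm) d) hd ?_ ?_ d rfl
  · intro d hd
    have : secondChord hC hn = h.innerChord (D.root hm) := by
      refine Subtype.ext (Fin.ext ?_)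
      rw [h.innerChord_val, s.inner_val, root_val, if_pos (Nat.zero_le _)]
      rfl
    rw [this] at hd
    rw [h.innerChord.injective hd]
  · rintro a ha b hb hPa hab d rfl
    rcases h.outerChord_or_innerChord a with ⟨r, rfl⟩ | ⟨d', rfl⟩
    · rw [← C.chordAt_chord (h.outerChord r), hin] at ha
      obtain ⟨x, hx⟩ := ha
      exact absurd hx (s.outer_ne_inner _ _)
    · exact (hPa d' rfl).trans ((h.adj_innerChord _ _).1 hab).reachable

end FirstComponent

end RootedChordDiagram

/-! ### The one-chord diagram. -/

open RootedChordDiagram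

theorem mem_RCCD {n : ℕ} {C : RootedChordDiagram n} : C ∈ RCCD n ↔ C.Connected := by
  simp [RCCD]

theorem RootedChordDiagram.one_le_b {n : ℕ} {C : RootedChordDiagram n} (hn : 0 < n) :
    1 ≤ C.b := by
  obtain ⟨w, hw⟩ := C.exists_word_eq_append_true hn
  rw [C.b_eq, hw]
  exact one_le_firstTrue w

theorem RCCD_zero : RCCD 0 = ∅ := by
  refine Finset.eq_empty_of_forall_notMem fun C hC => ?_
  exact absurd (pos_of_connected (mem_RCCD.1 hC)) (lt_irrefl 0)

/-- The only diagram with one chord. -/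
def singleChord : RootedChordDiagram 1 := ⟨Fin.rev, fun x => Fin.rev_rev x, by decide⟩

theorem eq_singleChord (C : RootedChordDiagram 1) : C = singleChord := by
  refine Subtype.ext (funext fun x => ?_)
  have h1 := C.partner_ne x
  change C.1 x = Fin.rev x
  generalize C.1 x = y at h1
  revert x y
  decide

theorem singleChord_chord (c d : singleChord.Chord) : c = d := by
  have h : ∀ x : Fin (2 * 1), x < Fin.rev x → x = 0 := by decide
  exact Subtype.ext ((h c.1 c.2).trans (h d.1 d.2).symm)

theorem singleChord_connected : singleChord.Connected := by
  rw [connected_iff _ one_pos]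
  intro c
  rw [singleChord_chord c (singleChord.root one_pos)]

theorem singleChord_word : singleChord.word = [true] := by
  obtain ⟨w, hw⟩ := singleChord.exists_word_eq_append_true one_pos
  have hl : singleChord.word.length = 1 :=
    (List.length_map _).trans singleChord.length_intersectionOrder
  rw [hw, List.length_append, List.length_singleton] at hl
  rw [hw, List.length_eq_zero_iff.1 (by omega : w.length = 0), List.nil_append]

theorem RCCD_one : RCCD 1 = {singleChord} := by
  ext C
  rw [Finset.mem_singleton, mem_RCCD]
  exact ⟨fun _ => eq_singleChord C, fun h => h ▸ singleChord_connected⟩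

/-! ### Recurrences for the generating functions. -/

section Recurrences

variable {A : Type*} [CommSemiring A] (f : ℕ → A)

/-- Gluing is a bijection from triples (R, D, gap), and `2 * p.2 - 1` counts the gaps. A general
weight `φ` serves both a_j and h_l. -/
theorem sum_RCCD_eq_sum_antidiagonal (φ : ℕ → A) {n : ℕ} (hn : 2 ≤ n) :
    ∑ C ∈ RCCD n, C.monomial f * φ C.b =
      ∑ p ∈ Finset.HasAntidiagonal.antidiagonal n, (∑ R ∈ RCCD p.1, R.monomial f * f (R.b - 1)) *
        (((2 * p.2 - 1 : ℕ) : A) * ∑ D ∈ RCCD p.2, D.monomial f * φ (D.b + 1)) := by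
  have expand : ∀ p : ℕ × ℕ, (∑ R ∈ RCCD p.1, R.monomial f * f (R.b - 1)) *
        (((2 * p.2 - 1 : ℕ) : A) * ∑ D ∈ RCCD p.2, D.monomial f * φ (D.b + 1)) =
      ∑ x ∈ RCCD p.1 ×ˢ RCCD p.2 ×ˢ (Finset.univ : Finset (Fin (2 * p.2 - 1))),
        x.1.monomial f * f (x.1.b - 1) * (x.2.1.monomial f * φ (x.2.1.b + 1)) := by
    intro p
    rw [Finset.sum_product, Finset.sum_mul]
    refine Finset.sum_congr rfl fun R _ => ?_
    rw [Finset.sum_product]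
    simp only [Finset.sum_const, Finset.card_univ, Fintype.card_fin, nsmul_eq_mul]
    rw [Finset.mul_sum, Finset.mul_sum]
    exact Finset.sum_congr rfl fun D _ => by ring
  rw [Finset.sum_congr rfl fun p _ => expand p, Finset.sum_sigma']
  symm
  have hmem : ∀ x ∈ (Finset.HasAntidiagonal.antidiagonal n).sigma fun p : ℕ × ℕ =>
      RCCD p.1 ×ˢ RCCD p.2 ×ˢ (Finset.univ : Finset (Fin (2 * p.2 - 1))),
      x.1.1 + x.1.2 = n ∧ x.2.1.Connected ∧ x.2.2.1.Connected := by
    intro x hx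
    rw [Finset.mem_sigma, Finset.HasAntidiagonal.mem_antidiagonal, Finset.mem_product,
      Finset.mem_product,
      mem_RCCD, mem_RCCD] at hx
    exact ⟨hx.1, hx.2.1, hx.2.2.1⟩
  let shape : ∀ x ∈ (Finset.HasAntidiagonal.antidiagonal n).sigma fun p : ℕ × ℕ =>
      RCCD p.1 ×ˢ RCCD p.2 ×ˢ (Finset.univ : Finset (Fin (2 * p.2 - 1))),
      SplitShape x.1.1 x.1.2 n := fun x hx =>
    ⟨x.2.2.2.1, pos_of_connected (hmem x hx).2.1, by have := x.2.2.2.2; omega, (hmem x hx).1⟩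
  have hglue := fun x hx => Classical.choose_spec (exists_isSplit (shape x hx) x.2.1 x.2.2.1)
  refine Finset.sum_bij
    (fun x hx => Classical.choose (exists_isSplit (shape x hx) x.2.1 x.2.2.1)) ?_ ?_ ?_ ?_
  · intro x hx
    exact mem_RCCD.2 ((hglue x hx).connected (hmem x hx).2.1 (hmem x hx).2.2)
  · intro x hx y hy hxy
    have h1 := hglue x hx
    have h2 := hglue y hy
    rw [← hxy] at h2
    obtain ⟨hk, hg⟩ := h1.shape_eq h2 (hmem x hx).2.2 (hmem y hy).2.2
    have hadd := (hmem x hx).1.trans (hmem y hy).1.symm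
    obtain ⟨⟨k, m⟩, R, D, g⟩ := x
    obtain ⟨⟨k', m'⟩, R', D', g'⟩ := y
    obtain rfl : k = k' := hk
    obtain rfl : m = m' := by simp only at hadd; omega
    obtain rfl : g = g' := Fin.ext hg
    obtain ⟨rfl, rfl⟩ := h1.unique_parts h2
    rfl
  · intro C hC
    obtain ⟨k, m, s, R, D, h, hR, hD⟩ := exists_split (mem_RCCD.1 hC) hn
    have hx : (⟨(k, m), R, D, ⟨s.gap, by have := s.gap_lt; simp only; omega⟩⟩ :
        Σ p : ℕ × ℕ, RootedChordDiagram p.1 × RootedChordDiagram p.2 × Fin (2 * p.2 - 1)) ∈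
        (Finset.HasAntidiagonal.antidiagonal n).sigma fun p : ℕ × ℕ =>
      RCCD p.1 ×ˢ RCCD p.2 ×ˢ (Finset.univ : Finset (Fin (2 * p.2 - 1))) := by
      rw [Finset.mem_sigma, Finset.HasAntidiagonal.mem_antidiagonal, Finset.mem_product,
        Finset.mem_product]
      exact ⟨s.add_eq, mem_RCCD.2 hR, mem_RCCD.2 hD, Finset.mem_univ _⟩
    exact ⟨_, hx, (hglue _ hx).unique h⟩
  · intro x hx
    have h := hglue x hx
    rw [h.b_eq_add_one (hmem x hx).2.1 (hmem x hx).2.2,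
      h.monomial_eq_mul f (hmem x hx).2.1 (hmem x hx).2.2, mul_assoc _ (x.2.2.1.monomial f)]

open PowerSeries

/-- The linear operator multiplying the coefficient of `X ^ n` by `2 * n - 1`. -/
noncomputable def oddScale (a : A⟦X⟧) : A⟦X⟧ :=
  PowerSeries.mk fun n => ((2 * n - 1 : ℕ) : A) * coeff n a

theorem oddScale_natCast_mul (c : ℕ) (a : A⟦X⟧) :
    oddScale ((c : A⟦X⟧) * a) = (c : A⟦X⟧) * oddScale a := by
  ext n
  rw [← nsmul_eq_mul, ← nsmul_eq_mul]
  simp only [oddScale, coeff_mk, map_nsmul]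
  rw [mul_smul_comm]

theorem oddScale_sum {ι : Type*} (s : Finset ι) (a : ι → A⟦X⟧) :
    oddScale (∑ i ∈ s, a i) = ∑ i ∈ s, oddScale (a i) := by
  ext n
  simp [oddScale, Finset.mul_sum]

/-- This is 2(p + q) - 1 = (2p - 1) + (2q - 1) + 1. Constant terms must vanish since the truncated
`2 * 0 - 1` is 0. -/
theorem oddScale_mul {a b : A⟦X⟧} (ha : coeff 0 a = 0) (hb : coeff 0 b = 0) :
    oddScale (a * b) = oddScale a * b + a * oddScale b + a * b := by
  ext n
  simp only [oddScale, coeff_mk, map_add, coeff_mul, Finset.mul_sum, ← Finset.sum_add_distrib]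
  refine Finset.sum_congr rfl fun p hp => ?_
  rw [Finset.HasAntidiagonal.mem_antidiagonal] at hp
  rcases Nat.eq_zero_or_pos p.1 with h1 | h1
  · rw [h1, ha]; simp
  rcases Nat.eq_zero_or_pos p.2 with h2 | h2
  · rw [h2, hb]; simp
  have : 2 * n - 1 = (2 * p.1 - 1) + (2 * p.2 - 1) + 1 := by omega
  rw [this]
  push_cast
  ring

/-- The generating function of the connected diagrams with `b = j + 1`. -/
noncomputable def bSeries (j : ℕ) : A⟦X⟧ :=
  PowerSeries.mk fun n => ∑ C ∈ RCCD n with C.b = j + 1, C.monomial f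

/-- The generating function of the connected diagrams with `l ≤ b`, with the additional weight
`f (b - l)`. -/
noncomputable def shiftSeries (l : ℕ) : A⟦X⟧ :=
  PowerSeries.mk fun n => ∑ C ∈ RCCD n with l ≤ C.b, C.monomial f * f (C.b - l)

theorem coeff_zero_bSeries (j : ℕ) : coeff 0 (bSeries f j) = 0 := by
  rw [bSeries, coeff_mk, RCCD_zero]; rfl

theorem coeff_zero_shiftSeries (j : ℕ) : coeff 0 (shiftSeries f j) = 0 := by
  rw [shiftSeries, coeff_mk, RCCD_zero]; rfl

theorem coeff_shiftSeries_one (n : ℕ) :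
    coeff n (shiftSeries f 1) = ∑ C ∈ RCCD n, C.monomial f * f (C.b - 1) := by
  rw [shiftSeries, coeff_mk, Finset.filter_true_of_mem]
  exact fun C hC => one_le_b (pos_of_connected (mem_RCCD.1 hC))

theorem b_singleChord : singleChord.b = 1 := by
  rw [RootedChordDiagram.b_eq, singleChord_word, firstTrue_singleton_true]

/-- Series weighted by a function of `b` that vanishes at `1` satisfy the recurrence of the
decomposition at the root. -/
theorem mk_sum_RCCD_eq_mul (φ : ℕ → A) (h1 : φ 1 = 0) :
    (PowerSeries.mk fun n => ∑ C ∈ RCCD n, C.monomial f * φ C.b) =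
      shiftSeries f 1 *
        oddScale (PowerSeries.mk fun n => ∑ C ∈ RCCD n, C.monomial f * φ (C.b + 1)) := by
  ext n
  rw [coeff_mk, coeff_mul]
  simp only [coeff_shiftSeries_one, oddScale, coeff_mk]
  rcases Nat.lt_or_ge n 2 with hn | hn
  · interval_cases n
    · simp [RCCD_zero]
    -- The one-chord diagram does not decompose; its weight is `φ 1 = 0`.
    · rw [Finset.Nat.antidiagonal_succ]
      simp [RCCD_zero, RCCD_one, b_singleChord, h1]
  · exact sum_RCCD_eq_sum_antidiagonal f φ hn

theorem bSeries_eq (j : ℕ) : bSeries f j =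
    PowerSeries.mk fun n => ∑ C ∈ RCCD n, C.monomial f * if C.b = j + 1 then 1 else 0 := by
  ext n
  simp [bSeries, Finset.sum_filter]

theorem shiftSeries_eq (l : ℕ) : shiftSeries f l =
    PowerSeries.mk fun n => ∑ C ∈ RCCD n, C.monomial f * if l ≤ C.b then f (C.b - l) else 0 := by
  ext n
  simp [shiftSeries, Finset.sum_filter]

theorem bSeries_succ (j : ℕ) :
    bSeries f (j + 1) = shiftSeries f 1 * oddScale (bSeries f j) := by
  rw [bSeries_eq, bSeries_eq,
    mk_sum_RCCD_eq_mul f (fun b => if b = j + 1 + 1 then 1 else 0) (by simp)]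
  simp only [add_left_inj]

theorem shiftSeries_succ {l : ℕ} (hl : 1 ≤ l) :
    shiftSeries f (l + 1) = shiftSeries f 1 * oddScale (shiftSeries f l) := by
  rw [shiftSeries_eq f (l + 1), shiftSeries_eq f l,
    mk_sum_RCCD_eq_mul f (fun b => if l + 1 ≤ b then f (b - (l + 1)) else 0)
      (if_neg (by omega))]
  simp only [add_le_add_iff_right, Nat.add_sub_add_right]

/-- Gluing gives b ≥ 2, so only the one-chord diagram contributes, with factor 2·1 - 1 = 1. -/
theorem oddScale_bSeries_zero : oddScale (bSeries f 0) = bSeries f 0 := by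
  ext n
  rw [oddScale, coeff_mk]
  rcases Nat.lt_or_ge n 2 with hn | hn
  · interval_cases n
    · simp [coeff_zero_bSeries]
    · simp
  · have : coeff n (bSeries f 0) = 0 := by
      rw [bSeries_eq, coeff_mk, sum_RCCD_eq_sum_antidiagonal f
        (fun b => if b = 0 + 1 then 1 else 0) hn]
      refine Finset.sum_eq_zero fun p _ => ?_
      rw [Finset.sum_eq_zero (s := RCCD p.2), mul_zero, mul_zero]
      intro D hD
      have := one_le_b (C := D) (pos_of_connected (mem_RCCD.1 hD))
      rw [if_neg (by omega), mul_zero]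
    rw [this, mul_zero]

/-- A binomial convolution identity for sequences generated by `a ↦ h * oddScale a`. -/
theorem eq_sum_choose_of_recurrence {a h : ℕ → A⟦X⟧} (ha0 : ∀ j, coeff 0 (a j) = 0)
    (hh0 : ∀ j, coeff 0 (h j) = 0) (ha : ∀ j, a (j + 1) = h 1 * oddScale (a j))
    (hh : ∀ l, 1 ≤ l → h (l + 1) = h 1 * oddScale (h l)) (h0 : oddScale (a 0) = a 0)
    {j : ℕ} (hj : 1 ≤ j) :
    a j = ∑ l ∈ Finset.Icc 1 j, (j.choose l : A⟦X⟧) * (h l * a (j - l)) := by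
  have reindex : ∀ j, ∑ l ∈ Finset.Icc 1 j, (j.choose l : A⟦X⟧) * (h l * a (j - l)) =
      ∑ l ∈ Finset.range j, (j.choose (l + 1) : A⟦X⟧) * (h (l + 1) * a (j - (l + 1))) := by
    intro j
    rw [Finset.range_eq_Ico, Finset.sum_Ico_add' (fun l => (j.choose l : A⟦X⟧) * (h l * a (j - l)))]
    rfl
  rw [reindex]
  induction j, hj using Nat.le_induction with
  | base => simp [ha, h0]
  | succ j hj ih =>
    -- By the induction hypothesis the extra products from `oddScale_mul` sum to `h 1 * a j`.
    have step : a (j + 1) = ∑ l ∈ Finset.range j, (j.choose (l + 1) : A⟦X⟧) *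
        (h (l + 2) * a (j - (l + 1)) + h (l + 1) * a (j - l)) + h 1 * a j := by
      rw [ha, ih, oddScale_sum, Finset.mul_sum, Finset.mul_sum, ← Finset.sum_add_distrib]
      refine Finset.sum_congr rfl fun l hl => ?_
      have hlj := Finset.mem_range.1 hl
      have e : j - l = j - (l + 1) + 1 := by omega
      rw [oddScale_natCast_mul, oddScale_mul (hh0 _) (ha0 _), e, ha, hh (l + 1) (by omega)]
      ring
    rw [step, Finset.sum_range_succ']
    have pascal : ∀ l, ((j + 1).choose (l + 1 + 1) : A⟦X⟧) =
        (j.choose (l + 1) : A⟦X⟧) + (j.choose (l + 2) : A⟦X⟧) := fun l => by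
      rw [Nat.choose_succ_succ]; push_cast; rfl
    simp only [pascal, mul_add, add_mul, Finset.sum_add_distrib, Nat.add_sub_add_right]
    -- Shifting the index releases the term `l = 0`; the new top term vanishes since `j.choose (j +
    -- 1) = 0`.
    have shift : ∑ l ∈ Finset.range j, (j.choose (l + 1) : A⟦X⟧) * (h (l + 1) * a (j - l)) =
        ∑ l ∈ Finset.range j, (j.choose (l + 2) : A⟦X⟧) * (h (l + 1 + 1) * a (j - (l + 1))) +
          (j : A⟦X⟧) * (h 1 * a j) := by
      have hs := Finset.sum_range_succ'
        (fun l => (j.choose (l + 1) : A⟦X⟧) * (h (l + 1) * a (j - l))) j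
      rw [Finset.sum_range_succ] at hs
      simpa using hs
    rw [shift]
    simp only [zero_add, Nat.choose_one_right, Nat.sub_zero]
    push_cast
    ring

end Recurrences

/-! ### Extracting the coefficient. -/

theorem mainTheorem3 {R : Type*} [CommSemiring R] (f : ℕ → R) (i j : ℕ) (hi : 1 ≤ i) (hj : 1 ≤ j) :
    ∑ C ∈ RCCD (i + 1) with C.b = j + 1, C.monomial f =
      ∑ k ∈ Finset.Icc 1 i, ∑ l ∈ Finset.Icc 1 j, (j.choose l : R) *
        (∑ C ∈ RCCD k with l ≤ C.b, C.monomial f * f (C.b - l)) *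
        (∑ C ∈ RCCD (i - k + 1) with C.b = j - l + 1, C.monomial f) := by
  have key := congrArg (PowerSeries.coeff (i + 1)) (eq_sum_choose_of_recurrence
    (coeff_zero_bSeries f) (coeff_zero_shiftSeries f) (bSeries_succ f)
    (fun l hl => shiftSeries_succ f hl) (oddScale_bSeries_zero f) hj)
  rw [bSeries, PowerSeries.coeff_mk] at key
  rw [key, map_sum, Finset.sum_comm]
  refine Finset.sum_congr rfl fun l _ => ?_
  -- The ends `k = 0` and `k = i + 1` of the convolution drop out, as neither series has a constant
  -- term.
  rw [← nsmul_eq_mul, map_nsmul, nsmul_eq_mul, PowerSeries.coeff_mul,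
    Finset.Nat.sum_antidiagonal_eq_sum_range_succ_mk, Finset.sum_range_succ, Finset.sum_range_succ',
    coeff_zero_shiftSeries, Nat.sub_self, coeff_zero_bSeries, zero_mul, mul_zero, add_zero,
    add_zero, Finset.mul_sum, Finset.range_eq_Ico,
    Finset.sum_Ico_add' (fun k => (j.choose l : R) * (PowerSeries.coeff k (shiftSeries f l) *
      PowerSeries.coeff (i + 1 - k) (bSeries f (j - l)))) 0 i 1]
  refine Finset.sum_congr rfl fun k hk => ?_
  have hki : i + 1 - k = i - k + 1 := by
    have := Finset.mem_Ico.1 hk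
    omega
  rw [hki, shiftSeries, bSeries, PowerSeries.coeff_mk, PowerSeries.coeff_mk, mul_assoc]
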